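/- Let $G=\mathrm{GL}_n(\mathbb R)$, $K=\mathrm O_n$, and let $\mathfrak{gl}_n=\mathfrak o_n\oplus\mathfrak p$ with $\mathfrak p=\mathrm{Sym}_n(\mathbb R)$, where $\mathfrak p$ carries the scalar product $\langle A,B\rangle_{\mathfrak p}=\mathrm{tr}(AB^\top)$. Let $\rho\colon G\to\mathrm{GL}(V)$ be an algebraic representation on a finite-dimensional real vector space, with differential $\pi=D\rho|_e$. Let $\bar g=\langle\cdot,\cdot\rangle_V$ be a scalar product on $V$ such that $\rho(k)$ is orthogonal for $k\in K$, $\pi(X)$ is symmetric for $X\in\mathfrak p$, and $\pi(X)$ is skew-symmetric for $X\in\mathfrak o_n$. For $v\in V\setminus\{0\}$ let $m(v)\in\mathfrak p$ be the element with $\langle m(v),X\rangle_{\mathfrak p}=\langle\pi(X)v,v\rangle_V/\langle v,v\rangle_V$ for all $X\in\mathfrak p$. For $h\in G$ let $(h\cdot\bar g)(x,y)=\langle\rho(h)^{-1}x,\rho(h)^{-1}y\rangle_V$ and $m^{h\cdot\bar g}(v)=h\,m(\rho(h)^{-1}v)\,h^{-1}$; this depends only on the scalar product $h\cdot\bar g$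 and on $v$, and $h^{-1}\cdot\bar g$ depends only on the coset $\bar h=Kh\in K\backslash G$. Let $l_{\bar h}\colon G\to K\backslash G$, $g\mapsto Khg$, and let $Dl_{\bar h}$ be its differential at the neutral element. Identify $A\in\mathrm{Sym}_n^+(\mathbb R)$ (positive definite symmetric matrices) with the scalar product $s(x,y)=\langle Ax,y\rangle$ on $\mathbb R^n$, and put ${}^s\bar g(x,y)=\langle\rho(A)x,y\rangle_V$, which is a scalar product of the form $h\cdot\bar g$. Fix $\bar v\in V\setminus\{0\}$, $h_0\in G$ and a real number $T>0$; put $v_0=\rho(h_0)\bar v$, $\bar h_0=Kh_0$ and $s_0(x,y)=\langle h_0x,h_0y\rangle$. Then there are bijections between the following three sets: 1. solutions $v\colon[0,T)\to V\setminus\{0\}$ of the gradient flow $v'(t)=-\pi(m(v(t)))\,v(t)$, $v(0)=v_0$; 2. solutions $\bar h\colon[0,T)\to K\backslash G$ of the moment map flow $\bar h'(t)=-Dl_{\bar h(t)}\bigl(m^{\bar h(t)^{-1}\cdot\bar g}(\bar v)\bigr)$, $\bar h(0)=\bar h_0$; 3. solutions $s\colon[0,T)\to\mathrm{Sym}_n^+(\mathbb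 R)$ of the metric flow $s'(t)=-2\,s(t)\bigl(m^{{}^{s(t)}\bar g}(\bar v)\,\cdot\,,\,\cdot\,\bigr)$, $s(0)=s_0$. More precisely, the bijections can be chosen such that $v$ corresponds to $\bar h$ with $v(t)=\rho(h(t))\bar v$ and $\bar h(t)=Kh(t)$ for a curve $h\colon[0,T)\to G$ with $h'(t)=-m(v(t))\,h(t)$ and $h(0)=h_0$, and such that $\bar h$ corresponds to $s$ with $s(t)=\phi(\bar h(t))$, where $\phi(Kh)=h^\top h$. -/

import Mathlib

open scoped Matrix ContDiff

noncomputable section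

namespace MomentFlow

variable {n : ℕ} {V : Type*} [NormedAddCommGroup V] [InnerProductSpace ℝ V]

/-! ### The group `G = GL_n(ℝ)`, the subgroup `K = O_n`, the space `K \ G` and the cone `Sym_n⁺(ℝ)` -/

/-- `GL_n(ℝ)` is an open subset of the space of matrices. A function on `GL_n(ℝ)` is regarded as a
function of matrices, with the irrelevant value `0` at singular matrices, so that its
differentials can be taken; the tangent spaces of `GL_n(ℝ)` are thereby the space of matrices. -/
def onGL {E : Type*} [Zero E] (F : GL (Fin n) ℝ → E) : Matrix (Fin n) (Fin n) ℝ → E :=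
  Function.extend Units.val F 0

/-- A function on `[0, T)`, regarded as a function on `ℝ` with the irrelevant value `0` outside of
`[0, T)`. Only its derivatives within `[0, T)` are taken. -/
def onIco {E : Type*} [Zero E] {T : ℝ} (u : Set.Ico (0 : ℝ) T → E) : ℝ → E :=
  Function.extend Subtype.val u 0

/-- The orthogonal group `K = O_n = {g ∈ GL_n(ℝ) : gᵀ = g⁻¹}`. -/
def orthogonalSubgroup (n : ℕ) : Subgroup (GL (Fin n) ℝ) where
  carrier := {g | (g : Matrix (Fin n) (Fin n) ℝ)ᵀ = ((g⁻¹ : GL (Fin n) ℝ) :)}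
  one_mem' := by simp
  mul_mem' := by
    intro a b ha hb
    simp only [Set.mem_ofPred_eq] at ha hb ⊢
    simp only [Units.val_mul, mul_inv_rev, Matrix.transpose_mul, ha, hb]
  inv_mem' := by
    intro a ha
    simp only [Set.mem_ofPred_eq] at ha ⊢
    rw [← ha, Matrix.transpose_transpose, inv_inv]

/-- The homogeneous space `K \ G` of cosets `K h`. -/
abbrev CosetSpace (n : ℕ) : Type := Quotient (QuotientGroup.rightRel (orthogonalSubgroup n))

/-- The coset `K h`. -/
def coset (h : GL (Fin n) ℝ) : CosetSpace n := Quotient.mk _ h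

theorem coset_eq_iff {a b : GL (Fin n) ℝ} :
    coset a = coset b ↔ b * a⁻¹ ∈ orthogonalSubgroup n := by
  unfold coset
  rw [Quotient.eq]
  exact QuotientGroup.rightRel_apply

/-- The map `l_{K h} : G → K \ G`, `g ↦ K h g`; it depends on the coset `K h` only. -/
def cosetTranslation (c : CosetSpace n) (g : GL (Fin n) ℝ) : CosetSpace n :=
  Quotient.lift (fun h : GL (Fin n) ℝ => coset (h * g)) (by
    intro a b hab
    have h : b * a⁻¹ ∈ orthogonalSubgroup n := QuotientGroup.rightRel_apply.1 hab
    rw [coset_eq_iff]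
    simpa [mul_assoc] using h) c

/-- Smooth functions on the manifold `K \ G`: those whose pullback to `G` is smooth. -/
def IsSmoothOnCosets (f : CosetSpace n → ℝ) : Prop :=
  ContDiffOn ℝ ∞
    (fun A : Fin n → Fin n → ℝ => onGL (fun g : GL (Fin n) ℝ => f (coset g)) (Matrix.of A))
    {A | IsUnit (Matrix.of A)}

/-- The tangent vector `D l_{K h}(X)` of `K \ G` at `K h`, where `l_{K h}` is differentiated at the
neutral element and `X ∈ 𝔤`. As usual, a tangent vector is given through its action
`f ↦ D(f ∘ l_{K h})|_e (X)` on smooth functions. -/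
def cosetTangent (c : CosetSpace n) (X : Matrix (Fin n) (Fin n) ℝ) (f : CosetSpace n → ℝ) : ℝ :=
  fderiv ℝ (onGL fun g : GL (Fin n) ℝ => f (cosetTranslation c g)) 1 X

/-- The curve `c` in `K \ G` is differentiable at `t ∈ [0, T)` with velocity the tangent vector `w`
(one-sided at `t = 0`): `(f ∘ c)'(t) = w(f)` for all smooth functions `f`. -/
def HasVelocityAt {T : ℝ} (c : Set.Ico (0 : ℝ) T → CosetSpace n)
    (w : (CosetSpace n → ℝ) → ℝ) (t : Set.Ico (0 : ℝ) T) : Prop :=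
  ∀ f : CosetSpace n → ℝ, IsSmoothOnCosets f →
    HasDerivWithinAt (onIco fun τ => f (c τ)) (w f) (Set.Ico 0 T) t

/-- The cone `Sym_n⁺(ℝ)` of positive definite symmetric matrices. -/
abbrev SymPos (n : ℕ) : Type := {A : Matrix (Fin n) (Fin n) ℝ // A.PosDef}

/-- A positive definite matrix as an element of `GL_n(ℝ)`. -/
def SymPos.toGL (A : SymPos n) : GL (Fin n) ℝ := A.2.isUnit.unit

/-- The scalar product `(x, y) ↦ ⟨A x, y⟩` on `W = ℝⁿ` that corresponds to `A ∈ Sym_n⁺(ℝ)`. -/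
def SymPos.form (A : SymPos n) (x y : Fin n → ℝ) : ℝ := (A.1 *ᵥ x) ⬝ᵥ y

/-- The positive definite matrix `hᵀ h`, i.e. the scalar product
`h⁻¹ · s̄ : (x, y) ↦ ⟨h x, h y⟩` on `W = ℝⁿ`. -/
def gram (h : GL (Fin n) ℝ) : SymPos n :=
  ⟨(h : Matrix (Fin n) (Fin n) ℝ)ᵀ * h, by
    have := Matrix.PosDef.conjTranspose_mul_self (h : Matrix (Fin n) (Fin n) ℝ)
      (Matrix.mulVec_injective_of_isUnit h.isUnit)
    simpa using this⟩

theorem gram_form (h : GL (Fin n) ℝ) (x y : Fin n → ℝ) :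
    (gram h).form x y
      = ((h : Matrix (Fin n) (Fin n) ℝ) *ᵥ x) ⬝ᵥ ((h : Matrix (Fin n) (Fin n) ℝ) *ᵥ y) := by
  simp only [SymPos.form, gram, ← Matrix.mulVec_mulVec]
  rw [Matrix.mulVec_transpose, ← Matrix.dotProduct_mulVec]

/-- The map `φ : K \ G → Sym_n⁺(ℝ)`, `K h ↦ hᵀ h`. -/
def cosetToSymPos (c : CosetSpace n) : SymPos n :=
  Quotient.lift (gram (n := n)) (by
    intro a b hab
    have h : b * a⁻¹ ∈ orthogonalSubgroup n := QuotientGroup.rightRel_apply.1 hab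
    obtain ⟨k, rfl⟩ : ∃ k, b = k * a := ⟨b * a⁻¹, by simp⟩
    have hk : (k : Matrix (Fin n) (Fin n) ℝ)ᵀ = ((k⁻¹ : GL (Fin n) ℝ) :) := by
      simpa [orthogonalSubgroup] using h
    apply Subtype.ext
    simp only [gram, Units.val_mul, Matrix.transpose_mul, hk]
    simp only [Matrix.mul_assoc]
    rw [← Matrix.mul_assoc ((k⁻¹ : GL (Fin n) ℝ) : Matrix (Fin n) (Fin n) ℝ)]
    rw [← Units.val_mul]
    simp) c

/-! ### Representations -/

/-- The representation `ρ` is algebraic: its matrix coefficients are polynomials in the entries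
of `g` and in `det(g)⁻¹`. -/
def IsAlgebraic (ρ : Representation ℝ (GL (Fin n) ℝ) V) : Prop :=
  ∀ (l : Module.Dual ℝ V) (v : V), ∃ (p : MvPolynomial (Fin n × Fin n) ℝ) (k : ℕ),
    ∀ g : GL (Fin n) ℝ, l (ρ g v)
      = MvPolynomial.eval (fun ij => (g : Matrix (Fin n) (Fin n) ℝ) ij.1 ij.2) p
        * ((g : Matrix (Fin n) (Fin n) ℝ).det)⁻¹ ^ k

variable [FiniteDimensional ℝ V]

/-- The differential `π = Dρ|_e : 𝔤𝔩_n → 𝔤𝔩(V)` of `ρ` at the neutral element. -/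
def dRep (ρ : Representation ℝ (GL (Fin n) ℝ) V) :
    Matrix (Fin n) (Fin n) ℝ →L[ℝ] (V →L[ℝ] V) :=
  fderiv ℝ (onGL fun g : GL (Fin n) ℝ => LinearMap.toContinuousLinearMap (ρ g)) 1

/-- The scalar product `ḡ` of `V` is adapted to the representation `ρ` and the Cartan decomposition
`𝔤𝔩_n = 𝔬_n ⊕ Sym_n(ℝ)`: the elements of `K` act by orthogonal transformations, symmetric matrices
act infinitesimally by symmetric and skew-symmetric ones by skew-symmetric endomorphisms. -/
structure IsAdapted (ρ : Representation ℝ (GL (Fin n) ℝ) V) : Prop where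
  orthogonal : ∀ k ∈ orthogonalSubgroup n, ∀ x y : V, inner ℝ (ρ k x) (ρ k y) = inner ℝ x y
  symmetric : ∀ X : Matrix (Fin n) (Fin n) ℝ, Xᵀ = X →
    ∀ x y : V, inner ℝ (dRep ρ X x) y = inner ℝ x (dRep ρ X y)
  skew : ∀ X : Matrix (Fin n) (Fin n) ℝ, Xᵀ = -X →
    ∀ x y : V, inner ℝ (dRep ρ X x) y = -inner ℝ x (dRep ρ X y)

/-! ### The moment map -/

/-- The quotient `⟨π(X) v, v⟩ / ⟨v, v⟩`. -/
def rayleigh (ρ : Representation ℝ (GL (Fin n) ℝ) V) (v : V)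
    (X : Matrix (Fin n) (Fin n) ℝ) : ℝ :=
  inner ℝ (dRep ρ X v) v / inner ℝ v v

/-- The moment map `m : V ∖ {0} → Sym_n(ℝ)`, where `Sym_n(ℝ)` carries the scalar product
`tr(A Bᵀ)`. It is given here by its matrix entries; `momentMap_isSymm`, `momentMap_trace` and
`momentMap_unique` show that `m(v)` is the only symmetric matrix with
`⟨m(v), X⟩ = ⟨π(X) v, v⟩ / ⟨v, v⟩` for all symmetric matrices `X`. -/
def momentMap (ρ : Representation ℝ (GL (Fin n) ℝ) V) (v : V) : Matrix (Fin n) (Fin n) ℝ :=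
  Matrix.of fun i j =>
    rayleigh ρ v ((1 / 2 : ℝ) • (Matrix.single i j 1 + Matrix.single j i 1))

theorem rayleigh_sum {ι : Type*} (s : Finset ι) (ρ : Representation ℝ (GL (Fin n) ℝ) V) (v : V)
    (a : ι → ℝ) (X : ι → Matrix (Fin n) (Fin n) ℝ) :
    rayleigh ρ v (∑ i ∈ s, a i • X i) = ∑ i ∈ s, a i * rayleigh ρ v (X i) := by
  simp only [rayleigh, map_sum, map_smul, _root_.sum_apply,
    _root_.smul_apply, sum_inner, inner_smul_left, Finset.sum_div, mul_div_assoc]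
  simp

theorem momentMap_isSymm (ρ : Representation ℝ (GL (Fin n) ℝ) V) (v : V) :
    (momentMap ρ v)ᵀ = momentMap ρ v := by
  ext i j
  simp [momentMap, add_comm]

theorem momentMap_trace (ρ : Representation ℝ (GL (Fin n) ℝ) V) (v : V)
    {X : Matrix (Fin n) (Fin n) ℝ} (hX : Xᵀ = X) :
    (momentMap ρ v * Xᵀ).trace = rayleigh ρ v X := by
  have hX' : X = ∑ p : Fin n × Fin n, X p.1 p.2 •
      ((1 / 2 : ℝ) • (Matrix.single p.1 p.2 1 + Matrix.single p.2 p.1 1)) := by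
    have h1 : X = ∑ i, ∑ j, Matrix.single i j (X i j) := Matrix.matrix_eq_sum_single X
    have h2 : X = ∑ i, ∑ j, Matrix.single j i (X i j) := by
      conv_lhs => rw [← hX, Matrix.matrix_eq_sum_single Xᵀ, Finset.sum_comm]
      rfl
    have h3 : X = (1 / 2 : ℝ) • (X + X) := by
      rw [← two_smul ℝ X, smul_smul]; norm_num
    rw [Fintype.sum_prod_type]
    have h4 : X = (1 / 2 : ℝ) • ((∑ i, ∑ j, Matrix.single i j (X i j))
        + ∑ i, ∑ j, Matrix.single j i (X i j)) := by rw [← h1, ← h2]; exact h3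
    refine h4.trans ?_
    simp only [← Finset.sum_add_distrib, Finset.smul_sum]
    refine Finset.sum_congr rfl fun i _ => Finset.sum_congr rfl fun j _ => ?_
    rw [smul_comm, smul_add (X i j)]
    simp [Matrix.smul_single]
  conv_rhs => rw [hX', rayleigh_sum, Fintype.sum_prod_type]
  simp only [Matrix.trace, Matrix.diag, Matrix.mul_apply, Matrix.transpose_apply, momentMap,
    Matrix.of_apply]
  exact Finset.sum_congr rfl fun i _ => Finset.sum_congr rfl fun j _ => mul_comm _ _

theorem momentMap_unique (ρ : Representation ℝ (GL (Fin n) ℝ) V) (v : V)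
    {M : Matrix (Fin n) (Fin n) ℝ} (hM : Mᵀ = M)
    (h : ∀ X : Matrix (Fin n) (Fin n) ℝ, Xᵀ = X → (M * Xᵀ).trace = rayleigh ρ v X) :
    M = momentMap ρ v := by
  have hs : (M - momentMap ρ v)ᵀ = M - momentMap ρ v := by
    rw [Matrix.transpose_sub, hM, momentMap_isSymm]
  have h0 : ((M - momentMap ρ v) * (M - momentMap ρ v)ᵀ).trace = 0 := by
    rw [Matrix.sub_mul, Matrix.trace_sub, h _ hs, momentMap_trace ρ v hs, sub_self]
  have := (Matrix.trace_mul_conjTranspose_self_eq_zero_iff (A := M - momentMap ρ v)).1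
    (by simpa using h0)
  exact sub_eq_zero.1 this

/-- The scalar product `h · ḡ : (x, y) ↦ ⟨ρ(h)⁻¹ x, ρ(h)⁻¹ y⟩` on `V`. -/
def translatedMetric (ρ : Representation ℝ (GL (Fin n) ℝ) V) (h : GL (Fin n) ℝ) (x y : V) : ℝ :=
  inner ℝ (ρ h⁻¹ x) (ρ h⁻¹ y)

/-- The matrix `Ad_h(m(ρ(h)⁻¹ v))`, which is the value of `m^{h · ḡ}` at `v`. -/
def translatedMomentMap (ρ : Representation ℝ (GL (Fin n) ℝ) V) (h : GL (Fin n) ℝ) (v : V) :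
    Matrix (Fin n) (Fin n) ℝ :=
  (h : Matrix (Fin n) (Fin n) ℝ) * momentMap ρ (ρ h⁻¹ v) * ((h⁻¹ : GL (Fin n) ℝ) :)

open Classical in
/-- The moment map `m^{g'}` with respect to a scalar product `g'` of the form `g' = h · ḡ`, that is
`m^{h · ḡ}(v) = Ad_h(m(ρ(h)⁻¹ v))`. By `momentMapOf_translatedMetric` this only depends on the
scalar product `h · ḡ`. (If `g'` is not of this form, then the value is irrelevant.) -/
def momentMapOf (ρ : Representation ℝ (GL (Fin n) ℝ) V) (g' : V → V → ℝ) (v : V) :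
    Matrix (Fin n) (Fin n) ℝ :=
  if H : ∃ h : GL (Fin n) ℝ, translatedMetric ρ h = g' then
    translatedMomentMap ρ H.choose v
  else 0

theorem onGL_coe {E : Type*} [Zero E] (F : GL (Fin n) ℝ → E) (g : GL (Fin n) ℝ) :
    onGL F (g : Matrix (Fin n) (Fin n) ℝ) = F g :=
  Units.val_injective.extend_apply F 0 g

theorem onGL_of_not_isUnit {E : Type*} [Zero E] (F : GL (Fin n) ℝ → E)
    {A : Matrix (Fin n) (Fin n) ℝ} (hA : ¬ IsUnit A) : onGL F A = 0 :=
  Function.extend_apply' (f := Units.val) F 0 A hA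

/-- `π ∘ Ad_h = Ad_{ρ(h)} ∘ π`. -/
theorem dRep_conj (ρ : Representation ℝ (GL (Fin n) ℝ) V) (h : GL (Fin n) ℝ)
    (X : Matrix (Fin n) (Fin n) ℝ) (v : V) :
    dRep ρ ((h : Matrix (Fin n) (Fin n) ℝ) * X * ((h⁻¹ : GL (Fin n) ℝ) :)) v
      = ρ h (dRep ρ X (ρ h⁻¹ v)) := by
  let _ : NormedAddCommGroup (Matrix (Fin n) (Fin n) ℝ) := Matrix.frobeniusNormedAddCommGroup
  let _ : NormedSpace ℝ (Matrix (Fin n) (Fin n) ℝ) := Matrix.frobeniusNormedSpace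
  set F : Matrix (Fin n) (Fin n) ℝ → (V →L[ℝ] V) :=
    onGL fun g : GL (Fin n) ℝ => LinearMap.toContinuousLinearMap (ρ g) with hF
  let C : Matrix (Fin n) (Fin n) ℝ ≃L[ℝ] Matrix (Fin n) (Fin n) ℝ :=
    LinearEquiv.toContinuousLinearEquiv
      { toFun := fun A => (h : Matrix (Fin n) (Fin n) ℝ) * A * ((h⁻¹ : GL (Fin n) ℝ) :)
        invFun := fun A => ((h⁻¹ : GL (Fin n) ℝ) : Matrix (Fin n) (Fin n) ℝ) * A * h
        map_add' := fun A B => by rw [mul_add, add_mul]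
        map_smul' := fun r A => by simp
        left_inv := fun A => by simp [mul_assoc]
        right_inv := fun A => by simp [mul_assoc] }
  have hC : ∀ A, C A = (h : Matrix (Fin n) (Fin n) ℝ) * A * ((h⁻¹ : GL (Fin n) ℝ) :) :=
    fun A => rfl
  have hinv : ∀ (g : GL (Fin n) ℝ) (x : V), ρ g (ρ g⁻¹ x) = x := fun g x => by
    rw [← Module.End.mul_apply, ← map_mul]; simp
  have hinv' : ∀ (g : GL (Fin n) ℝ) (x : V), ρ g⁻¹ (ρ g x) = x := fun g x => by
    rw [← Module.End.mul_apply, ← map_mul]; simp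
  let P : V →L[ℝ] V := LinearMap.toContinuousLinearMap (ρ h)
  let Q : V →L[ℝ] V := LinearMap.toContinuousLinearMap (ρ h⁻¹)
  let D : (V →L[ℝ] V) ≃L[ℝ] (V →L[ℝ] V) :=
    LinearEquiv.toContinuousLinearEquiv
      { toFun := fun B => P ∘L B ∘L Q
        invFun := fun B => Q ∘L B ∘L P
        map_add' := fun A B => by ext; simp
        map_smul' := fun r A => by ext; simp
        left_inv := fun A => by ext x; simp [P, Q, hinv']
        right_inv := fun A => by ext x; simp [P, Q, hinv] }
  have hFC : F ∘ C = D ∘ F := by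
    funext A
    by_cases hA : IsUnit A
    · obtain ⟨g, rfl⟩ := hA
      have : C (g : Matrix (Fin n) (Fin n) ℝ) = ((h * g * h⁻¹ : GL (Fin n) ℝ) :) := by
        rw [hC]; simp
      simp only [Function.comp_apply, this, hF, onGL_coe]
      ext x
      simp [D, P, Q]
    · have hCA : ¬ IsUnit (C A) := by
        rw [hC]
        intro hu
        apply hA
        have h2 := (h⁻¹.isUnit.mul hu).mul h.isUnit
        simpa [mul_assoc] using h2
      simp only [Function.comp_apply, hF, onGL_of_not_isUnit _ hA, onGL_of_not_isUnit _ hCA,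
        map_zero]
  have hC1 : C 1 = 1 := by rw [hC]; simp
  have h1 : fderiv ℝ (F ∘ C) 1 = (fderiv ℝ F (C 1)).comp (C : _ →L[ℝ] _) :=
    C.comp_right_fderiv
  have h2 : fderiv ℝ (D ∘ F) 1 = (D : _ →L[ℝ] _).comp (fderiv ℝ F 1) := D.comp_fderiv
  rw [hFC, h2, hC1] at h1
  have h3 := congrArg (fun L => L X v) h1
  exact h3.symm

theorem momentMap_trace_all {ρ : Representation ℝ (GL (Fin n) ℝ) V} (hρ : IsAdapted ρ) (v : V)
    (X : Matrix (Fin n) (Fin n) ℝ) : (momentMap ρ v * X).trace = rayleigh ρ v X := by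
  set S : Matrix (Fin n) (Fin n) ℝ := (1 / 2 : ℝ) • (X + Xᵀ) with hS
  set A : Matrix (Fin n) (Fin n) ℝ := (1 / 2 : ℝ) • (X - Xᵀ) with hA
  have hX : X = S + A := by
    rw [hS, hA, ← smul_add, add_add_sub_cancel, ← two_smul ℝ X, smul_smul]; norm_num
  have hSt : Sᵀ = S := by simp [hS, add_comm]
  have hAt : Aᵀ = -A := by simp [hA, ← smul_neg]
  have h1 : (momentMap ρ v * S).trace = rayleigh ρ v S := by
    have := momentMap_trace ρ v hSt
    rwa [hSt] at this
  have h2 : (momentMap ρ v * A).trace = 0 := by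
    have := Matrix.trace_transpose (momentMap ρ v * A)
    rw [Matrix.transpose_mul, hAt, momentMap_isSymm, Matrix.neg_mul, Matrix.trace_neg,
      Matrix.trace_mul_comm] at this
    linarith
  have h3 : rayleigh ρ v A = 0 := by
    have := hρ.skew A hAt v v
    rw [real_inner_comm v] at this
    have h0 : inner ℝ v (dRep ρ A v) = 0 := by linarith
    rw [rayleigh, real_inner_comm, h0, zero_div]
  have h4 : rayleigh ρ v X = rayleigh ρ v S + rayleigh ρ v A := by
    rw [hX]
    simp only [rayleigh, map_add, _root_.add_apply, inner_add_left, add_div]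
  rw [h4, h3, ← h1]
  conv_lhs => rw [hX, Matrix.mul_add, Matrix.trace_add, h2]

theorem translatedMomentMap_trace {ρ : Representation ℝ (GL (Fin n) ℝ) V} (hρ : IsAdapted ρ)
    (h : GL (Fin n) ℝ) (v : V) (X : Matrix (Fin n) (Fin n) ℝ) :
    (translatedMomentMap ρ h v * X).trace
      = translatedMetric ρ h (dRep ρ X v) v / translatedMetric ρ h v v := by
  have h1 : (translatedMomentMap ρ h v * X).trace
      = (momentMap ρ (ρ h⁻¹ v) * (((h⁻¹ : GL (Fin n) ℝ) : Matrix (Fin n) (Fin n) ℝ) * X *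
          (((h⁻¹)⁻¹ : GL (Fin n) ℝ) :))).trace := by
    rw [translatedMomentMap, inv_inv]
    rw [Matrix.mul_assoc, Matrix.mul_assoc, Matrix.trace_mul_comm]
    simp only [Matrix.mul_assoc]
  have hinv : ρ h (ρ h⁻¹ v) = v := by
    rw [← Module.End.mul_apply, ← map_mul]; simp
  rw [h1, momentMap_trace_all hρ, rayleigh, dRep_conj, inv_inv, hinv]
  rfl

theorem translatedMomentMap_congr {ρ : Representation ℝ (GL (Fin n) ℝ) V} (hρ : IsAdapted ρ)
    {a b : GL (Fin n) ℝ} (hab : translatedMetric ρ a = translatedMetric ρ b) (v : V) :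
    translatedMomentMap ρ a v = translatedMomentMap ρ b v := by
  refine Matrix.ext_iff_trace_mul_right.2 fun X => ?_
  rw [translatedMomentMap_trace hρ, translatedMomentMap_trace hρ, hab]

theorem momentMapOf_translatedMetric {ρ : Representation ℝ (GL (Fin n) ℝ) V} (hρ : IsAdapted ρ)
    (h : GL (Fin n) ℝ) (v : V) :
    momentMapOf ρ (translatedMetric ρ h) v = translatedMomentMap ρ h v := by
  have H : ∃ a : GL (Fin n) ℝ, translatedMetric ρ a = translatedMetric ρ h := ⟨h, rfl⟩
  rw [momentMapOf, dif_pos H]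
  exact translatedMomentMap_congr hρ H.choose_spec v

/-- The scalar product `h⁻¹ · ḡ` on `V`, which only depends on the coset `K h`. -/
def cosetMetric {ρ : Representation ℝ (GL (Fin n) ℝ) V} (hρ : IsAdapted ρ) (c : CosetSpace n) :
    V → V → ℝ :=
  Quotient.lift (fun h : GL (Fin n) ℝ => translatedMetric ρ h⁻¹) (by
    intro a b hab
    have h : b * a⁻¹ ∈ orthogonalSubgroup n := QuotientGroup.rightRel_apply.1 hab
    funext x y
    have := hρ.orthogonal _ h (ρ a x) (ρ a y)
    simp only [← Module.End.mul_apply, ← map_mul] at this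
    simpa [translatedMetric] using this.symm) c

/-- The scalar product `ᴬḡ : (x, y) ↦ ⟨ρ(A) x, y⟩` on `V` for `A ∈ Sym_n⁺(ℝ)`. -/
def symPosMetric (ρ : Representation ℝ (GL (Fin n) ℝ) V) (A : SymPos n) (x y : V) : ℝ :=
  inner ℝ (ρ A.toGL x) y

/-! ### The three flows on `[0, T)` -/

/-- Solutions on `[0, T)` of the gradient flow `v' = -π(m(v)) v`, `v(0) = v₀` on `V ∖ {0}`. -/
def gradientFlowSolutions (ρ : Representation ℝ (GL (Fin n) ℝ) V) (v₀ : V) (T : ℝ) :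
    Set (Set.Ico (0 : ℝ) T → V) :=
  {v | (∀ t, v t ≠ 0) ∧ (∀ t : Set.Ico (0 : ℝ) T, (t : ℝ) = 0 → v t = v₀) ∧
    ∀ t, HasDerivWithinAt (onIco v) (-(dRep ρ (momentMap ρ (v t)) (v t))) (Set.Ico 0 T) t}

/-- Solutions on `[0, T)` of the moment map flow `c' = -D l_c (m^{c⁻¹ · ḡ}(v̄))`, `c(0) = c₀` on
`K \ G`. -/
def momentMapFlowSolutions {ρ : Representation ℝ (GL (Fin n) ℝ) V} (hρ : IsAdapted ρ) (vbar : V)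
    (c₀ : CosetSpace n) (T : ℝ) : Set (Set.Ico (0 : ℝ) T → CosetSpace n) :=
  {c | (∀ t : Set.Ico (0 : ℝ) T, (t : ℝ) = 0 → c t = c₀) ∧
    ∀ t, HasVelocityAt c (-cosetTangent (c t) (momentMapOf ρ (cosetMetric hρ (c t)) vbar)) t}

/-- Solutions on `[0, T)` of the metric flow `s' = -2 s(m^{ˢḡ}(v̄) · , ·)`, `s(0) = s₀` on the cone
`Sym_n⁺(ℝ)` of scalar products on `W = ℝⁿ`. -/
def metricFlowSolutions (ρ : Representation ℝ (GL (Fin n) ℝ) V) (vbar : V) (s₀ : SymPos n)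
    (T : ℝ) : Set (Set.Ico (0 : ℝ) T → SymPos n) :=
  {s | (∀ t : Set.Ico (0 : ℝ) T, (t : ℝ) = 0 → s t = s₀) ∧
    ∀ t, ∀ x y : Fin n → ℝ, HasDerivWithinAt (onIco fun τ => (s τ).form x y)
      (-2 * (s t).form (momentMapOf ρ (symPosMetric ρ (s t)) vbar *ᵥ x) y) (Set.Ico 0 T) t}

/-- The curve `h` in `GL_n(ℝ)` solves `h' = -m(v) h`, `h(0) = h₀` on `[0, T)`. -/
def IsLiftAlong (ρ : Representation ℝ (GL (Fin n) ℝ) V) (h₀ : GL (Fin n) ℝ) {T : ℝ}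
    (v : Set.Ico (0 : ℝ) T → V) (h : Set.Ico (0 : ℝ) T → GL (Fin n) ℝ) : Prop :=
  (∀ t : Set.Ico (0 : ℝ) T, (t : ℝ) = 0 → h t = h₀) ∧
    ∀ t, HasDerivWithinAt (onIco fun τ => (h τ : Matrix (Fin n) (Fin n) ℝ))
      (-(momentMap ρ (v t) * (h t : Matrix (Fin n) (Fin n) ℝ))) (Set.Ico 0 T) t

end MomentFlow

end

/-! All three flows are shadows of one equation on the group, h' = -m(ρ(h)v̄)h with h(0) = h₀, whose
solutions form `liftSolutions`. Such an h yields a gradient flow line ρ(h)v̄, a curve Kh, and a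
curve hᵀh of scalar products; the point is that h can be recovered uniquely from v = ρ(h)v̄ and from
s = hᵀh.

Recovery needs only linear equations. If v is given, h' = -m(v(t))h is linear in h with continuous
coefficients, so it is solvable on all of [0, T); then ρ(h)v̄ and v both solve w' = -π(m(v(t)))w and
agree. If s is given, put M(t) = m^{ˢḡ}(v̄). By equivariance hM = m(ρ(h)v̄)h whenever hᵀh = s, so
the equation to solve is h' = -hM, again linear. Its solution satisfies (hᵀh)' = -(hᵀh M + Mᵀhᵀh),
and s satisfies the same linear equation because sM is symmetric; hence hᵀh = s. The two arguments
are `exists_lift_of_gradientFlow` and `exists_lift_of_metricFlow`; injectivity is uniqueness for the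
same linear equations.

Curves in K \ G are compared with curves of scalar products through the injective map φ. That the
moment maps on both sides agree rests on ⟨ρ(hᵀh)x, y⟩ = ⟨ρ(h)x, ρ(h)y⟩ (`symPosMetric_gram`), which
follows from the polar decomposition and the self-adjointness of ρ(P) for positive definite P
(`inner_rep_of_posDef`). -/

noncomputable section
namespace MomentFlow

/-! ### Linear ordinary differential equations on `[0, T)` -/

section LinearODE

open Set Metric
open scoped NNReal

variable {E : Type*} [NormedAddCommGroup E] [NormedSpace ℝ E]

/-- The radial retraction onto the closed ball of radius `R` is Lipschitz. -/
theorem norm_radial_sub_le {R : ℝ} (hR : 0 < R) (x y : E) :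
    ‖(R / max R ‖x‖) • x - (R / max R ‖y‖) • y‖ ≤ 2 * ‖x - y‖ := by
  set a := max R ‖x‖ with ha
  set b := max R ‖y‖ with hb
  have ha0 : 0 < a := lt_max_of_lt_left hR
  have hb0 : 0 < b := lt_max_of_lt_left hR
  have hRa : R / a ≤ 1 := (div_le_one ha0).2 (le_max_left _ _)
  have hyb : ‖y‖ / b ≤ 1 := (div_le_one hb0).2 (le_max_right _ _)
  have hab : |b - a| ≤ ‖x - y‖ := by
    rw [hb, ha, norm_sub_rev]
    calc |max R ‖y‖ - max R ‖x‖| ≤ |‖y‖ - ‖x‖| := by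
          simpa [max_comm] using abs_max_sub_max_le_abs ‖y‖ ‖x‖ R
      _ ≤ _ := abs_norm_sub_norm_le y x
  -- One term for moving the point and one for changing the scaling factor; each is at most ‖x - y‖,
  -- whence the constant 2.
  have h1 : (R / a) • x - (R / b) • y = (R / a) • (x - y) + (R / a - R / b) • y := by
    rw [smul_sub, sub_smul]; abel
  have h2 : |R / a - R / b| * ‖y‖ = (R / a) * (‖y‖ / b) * |b - a| := by
    have : R / a - R / b = R / a / b * (b - a) := by field_simp
    rw [this, abs_mul, abs_of_pos (by positivity)]
    ring
  rw [h1]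
  refine (norm_add_le _ _).trans ?_
  rw [norm_smul, norm_smul, Real.norm_eq_abs, Real.norm_eq_abs, abs_of_pos (by positivity), h2]
  have h3 : R / a * (‖y‖ / b) ≤ 1 := mul_le_one₀ hRa (by positivity) hyb
  have h4 : R / a * ‖x - y‖ ≤ 1 * ‖x - y‖ := by gcongr
  have h5 : R / a * (‖y‖ / b) * |b - a| ≤ 1 * ‖x - y‖ := by gcongr
  linarith

theorem norm_radial_le {R : ℝ} (hR : 0 < R) (x : E) :
    ‖(R / max R ‖x‖) • x‖ ≤ R ∧ ‖(R / max R ‖x‖) • x‖ ≤ ‖x‖ := by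
  have ha0 : 0 < max R ‖x‖ := lt_max_of_lt_left hR
  rw [norm_smul, Real.norm_eq_abs, abs_of_pos (by positivity)]
  constructor
  · rw [div_mul_eq_mul_div, div_le_iff₀ ha0]
    gcongr
    exact le_max_right _ _
  · exact mul_le_of_le_one_left (norm_nonneg _) ((div_le_one ha0).2 (le_max_left _ _))

/-- Precomposing the field with the radial retraction onto a ball makes it globally bounded and
Lipschitz, so Picard–Lindelöf covers the whole interval in one step. Grönwall then keeps the
solution inside the ball, where the retraction is the identity. -/
theorem exists_hasDerivWithinAt_linear_Icc [CompleteSpace E] {A : ℝ → E →L[ℝ] E} {b : ℝ}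
    (hb : 0 ≤ b) (hA : ContinuousOn A (Icc 0 b)) (x₀ : E) :
    ∃ α : ℝ → E, α 0 = x₀ ∧ ∀ t ∈ Icc 0 b, HasDerivWithinAt α (A t (α t)) (Icc 0 b) t := by
  obtain ⟨C', hC'⟩ := isCompact_Icc.exists_bound_of_continuousOn hA
  set C : ℝ≥0 := Real.toNNReal C' with hCdef
  have hC : ∀ t ∈ Icc 0 b, ‖A t‖ ≤ C := fun t ht => (hC' t ht).trans (Real.le_coe_toNNReal C')
  -- The radius exceeds the Grönwall bound ‖x₀‖ exp(C b) for solutions on [0, b].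
  set R : ℝ≥0 := ⟨‖x₀‖ * Real.exp (C * b) + 1, by positivity⟩ with hRdef
  have hRval : (R : ℝ) = ‖x₀‖ * Real.exp (C * b) + 1 := rfl
  have hR : 0 < (R : ℝ) := by rw [hRval]; positivity
  let f : ℝ → E → E := fun t x => A t (((R : ℝ) / max (R : ℝ) ‖x‖) • x)
  have hf : IsPicardLindelof f (tmin := 0) (tmax := b) ⟨0, le_rfl, hb⟩ x₀
      (C * R * ⟨b, hb⟩) 0 (C * R) (C * 2) := by
    refine ⟨fun t ht => ?_, fun x _ => ?_, fun t ht x _ => ?_, ?_⟩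
    · refine LipschitzOnWith.of_dist_le_mul fun x _ y _ => ?_
      rw [dist_eq_norm, dist_eq_norm, ← map_sub]
      refine ((A t).le_opNorm _).trans ?_
      have := norm_radial_sub_le hR x y
      push_cast
      rw [mul_assoc]
      exact mul_le_mul (hC t ht) this (norm_nonneg _) C.2
    · exact hA.clm_apply continuousOn_const
    · refine ((A t).le_opNorm _).trans ?_
      push_cast
      exact mul_le_mul (hC t ht) (norm_radial_le hR x).1 (norm_nonneg _) C.2
    · simp only [sub_zero, sub_self, max_eq_left hb, NNReal.coe_mul, NNReal.coe_zero]
      exact le_rfl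
  obtain ⟨α, hα0, hα⟩ := hf.exists_eq_forall_mem_Icc_hasDerivWithinAt₀
  refine ⟨α, hα0, fun t ht => ?_⟩
  have hbound : ∀ t ∈ Icc 0 b, ‖α t‖ ≤ ‖x₀‖ * Real.exp (C * (t - 0)) := by
    intro t ht
    have := norm_le_gronwallBound_of_norm_deriv_right_le (f := α) (f' := fun t => f t (α t))
      (δ := ‖x₀‖) (K := C) (ε := 0) (a := 0) (b := b)
      (fun t ht => (hα t ht).continuousWithinAt)
      (fun t ht => (hα t (Ico_subset_Icc_self ht)).mono_of_mem_nhdsWithin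
        (Icc_mem_nhdsGE_of_mem ht)) (by simpa using congrArg norm hα0 |>.le)
      (fun t ht => by
        rw [add_zero]
        refine ((A t).le_opNorm _).trans ?_
        exact mul_le_mul (hC t (Ico_subset_Icc_self ht)) (norm_radial_le hR _).2
          (norm_nonneg _) C.2) t ht
    rwa [gronwallBound_ε0] at this
  have hle : ‖α t‖ ≤ R := by
    refine (hbound t ht).trans ?_
    rw [hRval, sub_zero]
    have : Real.exp (C * t) ≤ Real.exp (C * b) := by gcongr; exact ht.2
    nlinarith [norm_nonneg x₀]
  have := hα t ht
  simp only [f, max_eq_left hle, div_self hR.ne', one_smul] at this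
  exact this

/-- On each [0, b] with b < T the coefficients are bounded by compactness, and Grönwall applies to
the difference. No bound near T is needed. -/
theorem eqOn_of_hasDerivWithinAt_linear {A : ℝ → E →L[ℝ] E} {T : ℝ}
    (hA : ContinuousOn A (Ico 0 T)) {f g : ℝ → E}
    (hf : ∀ t ∈ Ico 0 T, HasDerivWithinAt f (A t (f t)) (Ico 0 T) t)
    (hg : ∀ t ∈ Ico 0 T, HasDerivWithinAt g (A t (g t)) (Ico 0 T) t) (h0 : f 0 = g 0) :
    EqOn f g (Ico 0 T) := by
  intro b hb
  have hsub : Icc 0 b ⊆ Ico 0 T := fun t ht => ⟨ht.1, ht.2.trans_lt hb.2⟩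
  obtain ⟨C, hC⟩ := isCompact_Icc.exists_bound_of_continuousOn (hA.mono hsub)
  have key := eq_zero_of_abs_deriv_le_mul_abs_self_of_eq_zero_right
    (f := fun t => f t - g t) (f' := fun t => A t (f t - g t)) (K := C) (a := 0) (b := b)
    (fun t ht => ((hf t (hsub ht)).sub (hg t (hsub ht))).continuousWithinAt.mono hsub)
    (fun t ht => by
      have ht' := hsub (Ico_subset_Icc_self ht)
      rw [map_sub]
      exact ((hf t ht').sub (hg t ht')).mono_of_mem_nhdsWithin (Ico_mem_nhdsGE_of_mem ht'))
    (by simp [h0])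
    (fun t ht => ((A t).le_opNorm _).trans
      (mul_le_mul_of_nonneg_right (hC t (Ico_subset_Icc_self ht)) (norm_nonneg _)))
    b ⟨hb.1, le_rfl⟩
  exact sub_eq_zero.1 key

/-- The coefficients may blow up at T, so solutions on the intervals [0, b] are glued; uniqueness
makes them compatible. -/
theorem exists_hasDerivWithinAt_linear_Ico [CompleteSpace E] {A : ℝ → E →L[ℝ] E} {T : ℝ} (hT : 0 < T)
    (hA : ContinuousOn A (Ico 0 T)) (x₀ : E) :
    ∃ α : ℝ → E, α 0 = x₀ ∧ ∀ t ∈ Ico 0 T, HasDerivWithinAt α (A t (α t)) (Ico 0 T) t := by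
  have hsub : ∀ b ∈ Ico 0 T, Icc 0 b ⊆ Ico 0 T := fun b hb t ht => ⟨ht.1, ht.2.trans_lt hb.2⟩
  have hex : ∀ b : ℝ, ∃ α : ℝ → E, b ∈ Ico 0 T → α 0 = x₀ ∧
      ∀ t ∈ Icc 0 b, HasDerivWithinAt α (A t (α t)) (Icc 0 b) t := by
    intro b
    by_cases hb : b ∈ Ico 0 T
    · obtain ⟨α, h⟩ := exists_hasDerivWithinAt_linear_Icc hb.1 (hA.mono (hsub b hb)) x₀
      exact ⟨α, fun _ => h⟩
    · exact ⟨0, fun h => absurd h hb⟩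
  choose β hβ using hex
  have hagree : ∀ b ∈ Ico 0 T, ∀ t ∈ Ico 0 b, β t t = β b t := by
    intro b hb t ht
    have htT : t ∈ Ico 0 T := ⟨ht.1, ht.2.trans hb.2⟩
    rcases ht.1.eq_or_lt with h | h
    · subst h; rw [(hβ 0 htT).1, (hβ b hb).1]
    have hst : Ico 0 t ⊆ Ico 0 T := fun s hs => ⟨hs.1, hs.2.trans htT.2⟩
    have e := eqOn_of_hasDerivWithinAt_linear (hA.mono hst) (f := β t) (g := β b)
      (fun s hs => ((hβ t htT).2 s (Ico_subset_Icc_self hs)).mono Ico_subset_Icc_self)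
      (fun s hs => ((hβ b hb).2 s ⟨hs.1, (hs.2.trans ht.2).le⟩).mono
        fun r hr => ⟨hr.1, (hr.2.trans ht.2).le⟩)
      ((hβ t htT).1.trans (hβ b hb).1.symm)
    -- Uniqueness gives equality on [0, t) only; continuity carries it to the endpoint t.
    have c1 : ContinuousOn (β t) (Icc 0 t) := fun s hs =>
      ((hβ t htT).2 s hs).continuousWithinAt
    have c2 : ContinuousOn (β b) (Icc 0 t) := fun s hs =>
      ((hβ b hb).2 s ⟨hs.1, hs.2.trans ht.2.le⟩).continuousWithinAt.mono
        fun r hr => ⟨hr.1, hr.2.trans ht.2.le⟩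
    exact e.of_subset_closure c1 c2 Ico_subset_Icc_self (by rw [closure_Ico h.ne])
      ⟨h.le, le_rfl⟩
  -- The diagonal is the glued solution: near t it coincides with β b for any b strictly between t
  -- and T.
  refine ⟨fun t => β t t, ?_, fun t ht => ?_⟩
  · exact (hβ 0 ⟨le_rfl, hT⟩).1
  obtain ⟨b, hb1, hb2⟩ := exists_between ht.2
  have hb : b ∈ Ico 0 T := ⟨ht.1.trans hb1.le, hb2⟩
  have hd := ((hβ b hb).2 t ⟨ht.1, hb1.le⟩).mono Ico_subset_Icc_self
  have hd' : HasDerivWithinAt (fun t => β t t) (A t (β b t)) (Ico 0 b) t :=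
    hd.congr (fun s hs => hagree b hb s hs) (hagree b hb t ⟨ht.1, hb1⟩)
  rw [← hagree b hb t ⟨ht.1, hb1⟩] at hd'
  refine hd'.mono_of_mem_nhdsWithin ?_
  have : Ico 0 b = Ico 0 T ∩ Iio b := by
    ext s; simp only [mem_Ico, mem_inter_iff, mem_Iio]
    exact ⟨fun h => ⟨⟨h.1, h.2.trans hb2⟩, h.2⟩, fun h => ⟨h.1.1, h.2⟩⟩
  rw [this]
  exact Filter.inter_mem self_mem_nhdsWithin (mem_nhdsWithin_of_mem_nhds (Iio_mem_nhds hb1))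

end LinearODE

end MomentFlow
end

noncomputable section
namespace MomentFlow

variable {n : ℕ} {V : Type*} [NormedAddCommGroup V] [InnerProductSpace ℝ V]

/-! ### Curves on `[0, T)` -/

theorem onIco_coe {E : Type*} [Zero E] {T : ℝ} (u : Set.Ico (0 : ℝ) T → E)
    (t : Set.Ico (0 : ℝ) T) : onIco u t = u t :=
  Subtype.val_injective.extend_apply u 0 t

/-- Replaces a curve on the subtype by a function on ℝ; the values outside [0, T) play no role. -/
theorem exists_extension {X : Type*} [Nonempty X] {T : ℝ} (u : Set.Ico (0 : ℝ) T → X) :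
    ∃ k : ℝ → X, (fun τ : Set.Ico (0 : ℝ) T => k τ) = u := by
  classical
  refine ⟨fun t => if ht : t ∈ Set.Ico 0 T then u ⟨t, ht⟩ else Classical.arbitrary X, ?_⟩
  funext τ
  exact dif_pos τ.2

theorem hasDerivWithinAt_onIco_iff {E : Type*} [NormedAddCommGroup E] [NormedSpace ℝ E]
    {T : ℝ} {k : ℝ → E} {d : E} {t : ℝ} (ht : t ∈ Set.Ico 0 T) :
    HasDerivWithinAt (onIco fun τ : Set.Ico (0 : ℝ) T => k τ) d (Set.Ico 0 T) t ↔
      HasDerivWithinAt k d (Set.Ico 0 T) t := by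
  have h : Set.EqOn (onIco fun τ : Set.Ico (0 : ℝ) T => k τ) k (Set.Ico 0 T) :=
    fun s hs => onIco_coe (fun τ : Set.Ico (0 : ℝ) T => k τ) ⟨s, hs⟩
  exact ⟨fun H => H.congr (fun s hs => (h hs).symm) (h ht).symm, fun H => H.congr h (h ht)⟩

/-! ### Linear equations on the general linear group -/

section MatrixCalculus

open scoped Matrix.Norms.Operator

/-- Invertibility comes from solving a' = Ba and b' = -bB side by side: ba has derivative zero and
equals 1 at time 0, so b is the inverse of a. -/
theorem exists_fundamental_solution {B : ℝ → Matrix (Fin n) (Fin n) ℝ} {T : ℝ} (hT : 0 < T)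
    (hB : ContinuousOn B (Set.Ico 0 T)) (g₀ : GL (Fin n) ℝ) :
    ∃ k : ℝ → GL (Fin n) ℝ, k 0 = g₀ ∧
      (∀ t ∈ Set.Ico 0 T, HasDerivWithinAt (fun τ => (k τ : Matrix (Fin n) (Fin n) ℝ))
        (B t * (k t : Matrix (Fin n) (Fin n) ℝ)) (Set.Ico 0 T) t) ∧
      ∀ t ∈ Set.Ico 0 T,
        HasDerivWithinAt (fun τ => (((k τ)⁻¹ : GL (Fin n) ℝ) : Matrix (Fin n) (Fin n) ℝ))
          (-((((k t)⁻¹ : GL (Fin n) ℝ) : Matrix (Fin n) (Fin n) ℝ) * B t)) (Set.Ico 0 T) t := by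
  classical
  let l := ContinuousLinearMap.mul ℝ (Matrix (Fin n) (Fin n) ℝ)
  have c1 : ContinuousOn (fun t => l (B t)) (Set.Ico 0 T) := l.continuous.comp_continuousOn hB
  have c2 : ContinuousOn (fun t => l.flip (-B t)) (Set.Ico 0 T) :=
    l.flip.continuous.comp_continuousOn hB.neg
  obtain ⟨a, ha0, ha⟩ := exists_hasDerivWithinAt_linear_Ico hT c1 (g₀ : Matrix (Fin n) (Fin n) ℝ)
  obtain ⟨b, hb0, hb⟩ := exists_hasDerivWithinAt_linear_Ico hT c2
    ((g₀⁻¹ : GL (Fin n) ℝ) : Matrix (Fin n) (Fin n) ℝ)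
  have hba : ∀ t ∈ Set.Ico 0 T, b t * a t = 1 := by
    -- A curve with zero derivative is constant, seen as uniqueness for the equation with zero
    -- coefficients.
    have := eqOn_of_hasDerivWithinAt_linear (A := fun _ => 0) (T := T) continuousOn_const
      (f := fun t => b t * a t) (g := fun _ => (1 : Matrix (Fin n) (Fin n) ℝ))
      (fun t ht => by
        refine ((hb t ht).mul (ha t ht)).congr_deriv ?_
        simp [l, mul_assoc])
      (fun t ht => by simpa using hasDerivWithinAt_const t _ _)
      (by simp [ha0, hb0])
    exact this
  let k : ℝ → GL (Fin n) ℝ := fun t =>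
    if ht : t ∈ Set.Ico 0 T then ⟨a t, b t, mul_eq_one_comm.1 (hba t ht), hba t ht⟩ else 1
  have hk : ∀ t ∈ Set.Ico 0 T, (k t : Matrix (Fin n) (Fin n) ℝ) = a t := fun t ht => by
    simp only [k, dif_pos ht]
  have hk' : ∀ t ∈ Set.Ico 0 T, (((k t)⁻¹ : GL (Fin n) ℝ) : Matrix (Fin n) (Fin n) ℝ) = b t :=
    fun t ht => by
      simp only [k, dif_pos ht]; rfl
  refine ⟨k, Units.ext ?_, fun t ht => ?_, fun t ht => ?_⟩
  · rw [hk 0 ⟨le_rfl, hT⟩, ha0]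
  · rw [hk t ht]
    exact (ha t ht).congr hk (hk t ht)
  · rw [hk' t ht]
    refine ((hb t ht).congr hk' (hk' t ht)).congr_deriv ?_
    simp [l]

end MatrixCalculus

variable [FiniteDimensional ℝ V]

/-! ### Differentiability of algebraic representations -/

section Rep

open scoped Matrix.Norms.Operator

theorem isOpen_isUnit_matrix : IsOpen {A : Matrix (Fin n) (Fin n) ℝ | IsUnit A} := Units.isOpen

/-- In a basis, the matrix coefficients are polynomials in the entries times powers of det⁻¹, and
det does not vanish at g. -/
theorem differentiableAt_onGL_rep {ρ : Representation ℝ (GL (Fin n) ℝ) V} (halg : IsAlgebraic ρ)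
    (g : GL (Fin n) ℝ) :
    DifferentiableAt ℝ (onGL fun g : GL (Fin n) ℝ => LinearMap.toContinuousLinearMap (ρ g))
      (g : Matrix (Fin n) (Fin n) ℝ) := by
  let b := Module.finBasis ℝ V
  choose p k hpk using halg
  let c : Fin (Module.finrank ℝ V) → Fin (Module.finrank ℝ V) → Matrix (Fin n) (Fin n) ℝ → ℝ :=
    fun i j A => MvPolynomial.eval (fun ij => A ij.1 ij.2) (p (b.coord i) (b j)) *
      (A.det)⁻¹ ^ k (b.coord i) (b j)
  let e : Fin (Module.finrank ℝ V) → Fin (Module.finrank ℝ V) → V →L[ℝ] V :=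
    fun i j => LinearMap.toContinuousLinearMap ((b.coord j).smulRight (b i))
  have heq : (onGL fun g : GL (Fin n) ℝ => LinearMap.toContinuousLinearMap (ρ g))
      =ᶠ[nhds (g : Matrix (Fin n) (Fin n) ℝ)] fun A => ∑ i, ∑ j, c i j A • e i j := by
    filter_upwards [isOpen_isUnit_matrix.mem_nhds g.isUnit] with A hA
    obtain ⟨a, rfl⟩ := hA
    rw [onGL_coe]
    refine ContinuousLinearMap.coe_injective (b.ext fun j => ?_)
    simp only [c, ← hpk]
    refine (b.sum_repr (ρ a (b j))).symm.trans ?_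
    simp [e, Finsupp.single_apply]
  refine DifferentiableAt.congr_of_eventuallyEq ?_ heq
  have hentry : ∀ i j, Differentiable ℝ fun A : Matrix (Fin n) (Fin n) ℝ => A i j := fun i j =>
    (LinearMap.toContinuousLinearMap (Matrix.entryLinearMap ℝ ℝ i j)).differentiable
  have hpoly : ∀ q : MvPolynomial (Fin n × Fin n) ℝ, Differentiable ℝ
      fun A : Matrix (Fin n) (Fin n) ℝ => MvPolynomial.eval (fun ij => A ij.1 ij.2) q := by
    intro q
    induction q using MvPolynomial.induction_on with
    | C r => simp
    | add q r hq hr => simp only [map_add]; exact hq.fun_add hr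
    | mul_X q i hq => simp only [map_mul, MvPolynomial.eval_X]; exact hq.fun_mul (hentry i.1 i.2)
  have hdet : Differentiable ℝ fun A : Matrix (Fin n) (Fin n) ℝ => A.det := by
    simp only [Matrix.det_apply]
    fun_prop
  have hg : (g : Matrix (Fin n) (Fin n) ℝ).det ≠ 0 :=
    ((Matrix.isUnit_iff_isUnit_det _).1 g.isUnit).ne_zero
  have hc : ∀ i j, DifferentiableAt ℝ (c i j) (g : Matrix (Fin n) (Fin n) ℝ) := fun i j =>
    (hpoly _).differentiableAt.mul ((hdet.differentiableAt.inv hg).pow _)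
  fun_prop

end Rep
end MomentFlow
end

noncomputable section
namespace MomentFlow

variable {n : ℕ} {V : Type*} [NormedAddCommGroup V] [InnerProductSpace ℝ V]

theorem rep_mul_apply (ρ : Representation ℝ (GL (Fin n) ℝ) V) (a b : GL (Fin n) ℝ) (v : V) :
    ρ a (ρ b v) = ρ (a * b) v := by
  rw [map_mul, Module.End.mul_apply]

theorem _root_.Matrix.PosDef.transpose_eq {A : Matrix (Fin n) (Fin n) ℝ} (hA : A.PosDef) :
    Aᵀ = A :=
  Matrix.conjTranspose_eq_transpose_of_trivial A ▸ hA.isHermitian.eq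

variable [FiniteDimensional ℝ V]

/-! ### Curves in the group acting on vectors; self-adjointness of ρ(P) -/

section Rep

open scoped Matrix.Norms.Operator

/-- Since ρ(k(τ)) = ρ(k(τ)k(t)⁻¹)ρ(k(t)), only the differential of ρ at the neutral element enters:
τ ↦ k(τ)k(t)⁻¹ passes through 1 with velocity X. -/
theorem hasDerivWithinAt_rep {ρ : Representation ℝ (GL (Fin n) ℝ) V} (halg : IsAlgebraic ρ)
    {k : ℝ → GL (Fin n) ℝ} {s : Set ℝ} {t : ℝ} {X : Matrix (Fin n) (Fin n) ℝ}
    (hk : HasDerivWithinAt (fun τ => (k τ : Matrix (Fin n) (Fin n) ℝ))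
      (X * (k t : Matrix (Fin n) (Fin n) ℝ)) s t) (v : V) :
    HasDerivWithinAt (fun τ => ρ (k τ) v) (dRep ρ X (ρ (k t) v)) s t := by
  have h1 : HasDerivWithinAt (fun τ => (k τ : Matrix (Fin n) (Fin n) ℝ) *
      (((k t)⁻¹ : GL (Fin n) ℝ) : Matrix (Fin n) (Fin n) ℝ)) X s t :=
    (hk.mul_const _).congr_deriv (by rw [mul_assoc]; simp)
  have h2 : HasFDerivAt (onGL fun g : GL (Fin n) ℝ => LinearMap.toContinuousLinearMap (ρ g))
      (dRep ρ) ((1 : GL (Fin n) ℝ) : Matrix (Fin n) (Fin n) ℝ) :=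
    (differentiableAt_onGL_rep halg 1).hasFDerivAt
  have h3 := h2.comp_hasDerivWithinAt_of_eq t h1 (by simp)
  have h4 := h3.clm_apply (hasDerivWithinAt_const t s (ρ (k t) v))
  have h5 : ∀ τ, onGL (fun g : GL (Fin n) ℝ => LinearMap.toContinuousLinearMap (ρ g))
      ((k τ : Matrix (Fin n) (Fin n) ℝ) * (((k t)⁻¹ : GL (Fin n) ℝ) : Matrix (Fin n) (Fin n) ℝ))
      (ρ (k t) v) = ρ (k τ) v := by
    intro τ
    rw [← Units.val_mul, onGL_coe, LinearMap.coe_toContinuousLinearMap', rep_mul_apply,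
      inv_mul_cancel_right]
  refine (h4.congr_deriv ?_).congr (fun τ _ => (h5 τ).symm) (h5 t).symm
  rw [map_zero, add_zero]
  rfl

theorem hasDerivWithinAt_inv {k : ℝ → GL (Fin n) ℝ} {s : Set ℝ} {t : ℝ}
    {D : Matrix (Fin n) (Fin n) ℝ}
    (hk : HasDerivWithinAt (fun τ => (k τ : Matrix (Fin n) (Fin n) ℝ)) D s t) :
    HasDerivWithinAt (fun τ => (((k τ)⁻¹ : GL (Fin n) ℝ) : Matrix (Fin n) (Fin n) ℝ))
      (-((((k t)⁻¹ : GL (Fin n) ℝ) : Matrix (Fin n) (Fin n) ℝ) * D *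
        (((k t)⁻¹ : GL (Fin n) ℝ) : Matrix (Fin n) (Fin n) ℝ))) s t := by
  have h := (hasFDerivAt_ringInverse (𝕜 := ℝ) (k t)).comp_hasDerivWithinAt t hk
  refine (h.congr_deriv ?_).congr (fun τ _ => ?_) ?_
  · simp
  · simp
  · simp

/-- No logarithm of P is used. Along the segment p(t) from 1 to P the pairing of ρ(p(t))x with
ρ(p(t))⁻¹ρ(P)y is constant, because p'p⁻¹ is symmetric and so acts by a symmetric endomorphism. Its
values at the two ends are the two sides. -/
theorem inner_rep_of_posDef {ρ : Representation ℝ (GL (Fin n) ℝ) V} (halg : IsAlgebraic ρ)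
    (hρ : IsAdapted ρ) {P : GL (Fin n) ℝ} (hP : (P : Matrix (Fin n) (Fin n) ℝ).PosDef) (x y : V) :
    inner ℝ (ρ P x) y = inner ℝ x (ρ P y) := by
  classical
  let p : ℝ → Matrix (Fin n) (Fin n) ℝ := fun t => 1 + t • ((P : Matrix (Fin n) (Fin n) ℝ) - 1)
  have hp : ∀ t ∈ Set.Icc (0 : ℝ) 1, (p t).PosDef := by
    intro t ht
    have : p t = (1 - t) • (1 : Matrix (Fin n) (Fin n) ℝ) + t • (P : Matrix (Fin n) (Fin n) ℝ) := by
      simp only [p, smul_sub, sub_smul, one_smul]; abel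
    rw [this]
    rcases ht.1.eq_or_lt with h | h
    · rw [← h]; simpa using Matrix.PosDef.one
    · exact Matrix.PosDef.posSemidef_add (Matrix.PosSemidef.one.smul (sub_nonneg.2 ht.2)) (hP.smul h)
  let k : ℝ → GL (Fin n) ℝ := fun t =>
    if ht : t ∈ Set.Icc (0 : ℝ) 1 then (hp t ht).isUnit.unit else 1
  have hk : ∀ t ∈ Set.Icc (0 : ℝ) 1, (k t : Matrix (Fin n) (Fin n) ℝ) = p t := fun t ht => by
    simp only [k, dif_pos ht, IsUnit.unit_spec]
  have hk0 : k 0 = 1 := Units.ext (by rw [hk 0 (by simp)]; simp [p])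
  have hk1 : k 1 = P := Units.ext (by rw [hk 1 (by simp)]; simp [p])
  set Q : Matrix (Fin n) (Fin n) ℝ := (P : Matrix (Fin n) (Fin n) ℝ) - 1 with hQ
  have hQt : Qᵀ = Q := by
    have : (P : Matrix (Fin n) (Fin n) ℝ)ᵀ = P := hP.transpose_eq
    rw [hQ, Matrix.transpose_sub, this, Matrix.transpose_one]
  let i : ℝ → Matrix (Fin n) (Fin n) ℝ := fun t => ((k t)⁻¹ : GL (Fin n) ℝ)
  -- p(t) = 1 + tQ commutes with Q, hence so does its inverse; therefore Q p(t)⁻¹ is symmetric.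
  have hcomm : ∀ t ∈ Set.Icc (0 : ℝ) 1, Q * i t = i t * Q := by
    intro t ht
    have h1 : Commute (k t : Matrix (Fin n) (Fin n) ℝ) Q := by
      rw [hk t ht]
      exact (Commute.one_left Q).add_left ((Commute.refl Q).smul_left t)
    exact (h1.units_inv_left).symm
  have hit : ∀ t ∈ Set.Icc (0 : ℝ) 1, (i t)ᵀ = i t := by
    intro t ht
    have : (k t : Matrix (Fin n) (Fin n) ℝ)ᵀ = k t := by
      rw [hk t ht]; exact (hp t ht).transpose_eq
    simp only [i, Matrix.coe_units_inv, Matrix.transpose_nonsing_inv, this]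
  have hd : ∀ t ∈ Set.Icc (0 : ℝ) 1, HasDerivWithinAt
      (fun τ => (k τ : Matrix (Fin n) (Fin n) ℝ)) Q (Set.Icc 0 1) t := by
    intro t ht
    have : HasDerivWithinAt p Q (Set.Icc 0 1) t := by
      exact ((((hasDerivAt_id t).smul_const Q).const_add 1).congr_deriv
        (one_smul _ _)).hasDerivWithinAt
    exact this.congr hk (hk t ht)
  set z := ρ P y with hz
  have hw : ∀ t ∈ Set.Icc (0 : ℝ) 1, HasDerivWithinAt
      (fun τ => inner ℝ (ρ (k τ) x) (ρ (k τ)⁻¹ z)) 0 (Set.Icc 0 1) t := by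
    intro t ht
    have d1 := hasDerivWithinAt_rep halg (k := k) (X := Q * i t)
      ((hd t ht).congr_deriv (by simp [i, mul_assoc])) x
    have d2 := hasDerivWithinAt_rep halg (k := fun τ => (k τ)⁻¹) (X := -(Q * i t))
      ((hasDerivWithinAt_inv (hd t ht)).congr_deriv (by
        change -(i t * Q * i t) = -(Q * i t) * i t
        rw [hcomm t ht, neg_mul])) z
    refine (d1.inner ℝ d2).congr_deriv ?_
    rw [hρ.symmetric (Q * i t) (by
      rw [Matrix.transpose_mul, hQt, hit t ht, hcomm t ht])]
    simp
  have hc := constant_of_has_deriv_right_zero (fun t ht => (hw t ht).continuousWithinAt)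
    (fun t ht => (hw t (Set.Ico_subset_Icc_self ht)).mono_of_mem_nhdsWithin
      (Icc_mem_nhdsGE_of_mem ht)) 1 (by simp)
  simpa only [hk0, hk1, one_mul, hz, rep_mul_apply, inv_mul_cancel, inv_one, map_one, Module.End.one_apply] using hc

end Rep

/-! ### The map h ↦ hᵀh and the comparison of scalar products -/

section Gram

open scoped MatrixOrder

theorem exists_posDef_mul_self (A : SymPos n) :
    ∃ p : GL (Fin n) ℝ, (p : Matrix (Fin n) (Fin n) ℝ).PosDef ∧ p * p = A.toGL := by
  have h0 : (CFC.sqrt A.1).PosSemidef := Matrix.nonneg_iff_posSemidef.1 (CFC.sqrt_nonneg A.1)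
  have h1 : CFC.sqrt A.1 * CFC.sqrt A.1 = A.1 := CFC.sqrt_mul_sqrt_self A.1 A.2.posSemidef.nonneg
  have hu : IsUnit (CFC.sqrt A.1) := by
    have := A.2.isUnit
    rw [← h1] at this
    exact isUnit_of_mul_isUnit_left this
  refine ⟨hu.unit, ?_, Units.ext ?_⟩
  · exact h0.posDef_iff_isUnit.2 hu
  · exact h1

theorem gram_of_posDef {p : GL (Fin n) ℝ} (hp : (p : Matrix (Fin n) (Fin n) ℝ).PosDef) :
    (gram p).1 = ((p * p : GL (Fin n) ℝ) : Matrix (Fin n) (Fin n) ℝ) := by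
  have : (p : Matrix (Fin n) (Fin n) ℝ)ᵀ = p := hp.transpose_eq
  simp [gram, this]

theorem gram_surjective : Function.Surjective (gram (n := n)) := by
  intro A
  obtain ⟨p, hp, hpA⟩ := exists_posDef_mul_self A
  exact ⟨p, Subtype.ext (by rw [gram_of_posDef hp, hpA]; rfl)⟩

theorem mem_orthogonalSubgroup_of_gram_eq {a b : GL (Fin n) ℝ} (h : gram a = gram b) :
    b * a⁻¹ ∈ orthogonalSubgroup n := by
  have h1 : (a : Matrix (Fin n) (Fin n) ℝ)ᵀ * a = (b : Matrix (Fin n) (Fin n) ℝ)ᵀ * b :=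
    congrArg Subtype.val h
  change ((b * a⁻¹ : GL (Fin n) ℝ) : Matrix (Fin n) (Fin n) ℝ)ᵀ
    = (((b * a⁻¹)⁻¹ : GL (Fin n) ℝ) : Matrix (Fin n) (Fin n) ℝ)
  symm
  rw [Units.inv_eq_of_mul_eq_one_left]
  have h2 : (a : Matrix (Fin n) (Fin n) ℝ) * (((a⁻¹ : GL (Fin n) ℝ) :) : Matrix (Fin n) (Fin n) ℝ)
      = 1 := by simp
  rw [Units.val_mul, Matrix.transpose_mul, mul_assoc, ← mul_assoc _ (b : Matrix (Fin n) (Fin n) ℝ),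
    ← h1, mul_assoc, h2, mul_one, ← Matrix.transpose_mul, h2, Matrix.transpose_one]

theorem cosetToSymPos_injective : Function.Injective (cosetToSymPos (n := n)) := by
  intro c d
  refine Quotient.inductionOn₂ c d fun a b h => ?_
  exact coset_eq_iff.2 (mem_orthogonalSubgroup_of_gram_eq h)

/-- With p the positive square root of hᵀh, the polar decomposition is h = kp with k orthogonal.
Then ρ(pp) = ρ(p)ρ(p), one factor moves across by self-adjointness, and ρ(k) is an isometry. -/
theorem symPosMetric_gram {ρ : Representation ℝ (GL (Fin n) ℝ) V} (halg : IsAlgebraic ρ)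
    (hρ : IsAdapted ρ) (h : GL (Fin n) ℝ) :
    symPosMetric ρ (gram h) = translatedMetric ρ h⁻¹ := by
  obtain ⟨p, hp, hpA⟩ := exists_posDef_mul_self (gram h)
  have hg : gram p = gram h := Subtype.ext (by rw [gram_of_posDef hp, hpA]; rfl)
  funext x y
  have hk := hρ.orthogonal _ (mem_orthogonalSubgroup_of_gram_eq hg) (ρ p x) (ρ p y)
  simp only [rep_mul_apply, inv_mul_cancel_right] at hk
  rw [symPosMetric, ← hpA, ← rep_mul_apply, inner_rep_of_posDef halg hρ hp, translatedMetric,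
    inv_inv, hk]

theorem momentMapOf_gram {ρ : Representation ℝ (GL (Fin n) ℝ) V} (halg : IsAlgebraic ρ)
    (hρ : IsAdapted ρ) (h : GL (Fin n) ℝ) (v : V) :
    momentMapOf ρ (symPosMetric ρ (gram h)) v = translatedMomentMap ρ h⁻¹ v := by
  rw [symPosMetric_gram halg hρ, momentMapOf_translatedMetric hρ]

theorem momentMapOf_coset {ρ : Representation ℝ (GL (Fin n) ℝ) V}
    (hρ : IsAdapted ρ) (h : GL (Fin n) ℝ) (v : V) :
    momentMapOf ρ (cosetMetric hρ (coset h)) v = translatedMomentMap ρ h⁻¹ v :=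
  momentMapOf_translatedMetric hρ h⁻¹ v

/-- Conjugation by `h` takes `m^{h⁻¹ · ḡ}(v)` to `m(ρ(h) v)`. -/
theorem mul_translatedMomentMap_inv (ρ : Representation ℝ (GL (Fin n) ℝ) V) (h : GL (Fin n) ℝ)
    (v : V) : (h : Matrix (Fin n) (Fin n) ℝ) * translatedMomentMap ρ h⁻¹ v
      = momentMap ρ (ρ h v) * (h : Matrix (Fin n) (Fin n) ℝ) := by
  rw [translatedMomentMap, inv_inv, mul_assoc, ← mul_assoc, ← Units.val_mul]
  simp

end Gram
end MomentFlow
end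

noncomputable section
namespace MomentFlow

variable {n : ℕ} {V : Type*} [NormedAddCommGroup V] [InnerProductSpace ℝ V]

open scoped Matrix.Norms.Operator

/-! ### Tangent vectors of `K \ G` -/

theorem IsSmoothOnCosets.differentiableAt {f : CosetSpace n → ℝ} (hf : IsSmoothOnCosets f)
    (h : GL (Fin n) ℝ) :
    DifferentiableAt ℝ (onGL fun g : GL (Fin n) ℝ => f (coset g))
      (h : Matrix (Fin n) (Fin n) ℝ) := by
  have hopen : IsOpen {A : Fin n → Fin n → ℝ | IsUnit (Matrix.of A)} := isOpen_isUnit_matrix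
  exact ((hf.differentiableOn (by simp)) (h : Matrix (Fin n) (Fin n) ℝ) h.isUnit).differentiableAt
    (hopen.mem_nhds h.isUnit)

/-- The map l_{Kh} is covered by left multiplication by h, which is linear on matrices, so the chain
rule applies. -/
theorem cosetTangent_coset {f : CosetSpace n → ℝ} (hf : IsSmoothOnCosets f)
    (h : GL (Fin n) ℝ) (X : Matrix (Fin n) (Fin n) ℝ) :
    cosetTangent (coset h) X f = fderiv ℝ (onGL fun g : GL (Fin n) ℝ => f (coset g))
      (h : Matrix (Fin n) (Fin n) ℝ) ((h : Matrix (Fin n) (Fin n) ℝ) * X) := by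
  let l := ContinuousLinearMap.mul ℝ (Matrix (Fin n) (Fin n) ℝ) (h : Matrix (Fin n) (Fin n) ℝ)
  have heq : (onGL fun g : GL (Fin n) ℝ => f (cosetTranslation (coset h) g))
      = (onGL fun g : GL (Fin n) ℝ => f (coset g)) ∘ l := by
    funext A
    by_cases hA : IsUnit A
    · obtain ⟨g, rfl⟩ := hA
      have : l (g : Matrix (Fin n) (Fin n) ℝ) = ((h * g : GL (Fin n) ℝ) :) := rfl
      rw [Function.comp_apply, this, onGL_coe, onGL_coe]
      rfl
    -- Left multiplication by h preserves singularity, so the two extensions by zero agree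
    -- everywhere.
    · have hlA : ¬ IsUnit (l A) := fun hu => hA ((Units.isUnit_units_mul h A).1 hu)
      rw [Function.comp_apply, onGL_of_not_isUnit _ hA, onGL_of_not_isUnit _ hlA]
  have hd := (hf.differentiableAt h).hasFDerivAt
  have h1 : HasFDerivAt ((onGL fun g : GL (Fin n) ℝ => f (coset g)) ∘ l)
      ((fderiv ℝ (onGL fun g : GL (Fin n) ℝ => f (coset g))
        (h : Matrix (Fin n) (Fin n) ℝ)).comp l) 1 := by
    refine HasFDerivAt.comp 1 ?_ l.hasFDerivAt
    rwa [show l 1 = (h : Matrix (Fin n) (Fin n) ℝ) from mul_one _]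
  rw [← heq] at h1
  exact DFunLike.congr_fun h1.fderiv X

theorem hasDerivWithinAt_comp_coset {f : CosetSpace n → ℝ} (hf : IsSmoothOnCosets f)
    {k : ℝ → GL (Fin n) ℝ} {s : Set ℝ} {t : ℝ} {X : Matrix (Fin n) (Fin n) ℝ}
    (hk : HasDerivWithinAt (fun τ => (k τ : Matrix (Fin n) (Fin n) ℝ))
      (-((k t : Matrix (Fin n) (Fin n) ℝ) * X)) s t) :
    HasDerivWithinAt (fun τ => f (coset (k τ))) ((-cosetTangent (coset (k t)) X) f) s t := by
  have h1 := (hf.differentiableAt (k t)).hasFDerivAt.comp_hasDerivWithinAt t hk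
  refine (h1.congr_deriv ?_).congr (fun τ _ => ?_) ?_
  · rw [Pi.neg_apply, cosetTangent_coset hf]
    exact map_neg (fderiv ℝ (onGL fun g : GL (Fin n) ℝ => f (coset g)) _) _
  · rw [Function.comp_apply, onGL_coe]
  · rw [Function.comp_apply, onGL_coe]

/-- These test functions read off the entries of φ, and they are polynomial in the entries of h. -/
theorem isSmoothOnCosets_form (x y : Fin n → ℝ) :
    IsSmoothOnCosets fun c : CosetSpace n => (cosetToSymPos c).form x y := by
  have h : ContDiff ℝ ∞ fun A : Fin n → Fin n → ℝ =>
      (((Matrix.of A)ᵀ * Matrix.of A) *ᵥ x) ⬝ᵥ y := by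
    simp only [Matrix.mulVec, dotProduct, Matrix.mul_apply, Matrix.transpose_apply,
      Matrix.of_apply]
    fun_prop
  refine h.contDiffOn.congr fun A hA => ?_
  obtain ⟨g, hg⟩ := (show IsUnit (Matrix.of A) from hA)
  rw [← hg, onGL_coe]
  rfl

theorem cosetTangent_form (h : GL (Fin n) ℝ) (X : Matrix (Fin n) (Fin n) ℝ) (x y : Fin n → ℝ) :
    cosetTangent (coset h) X (fun c => (cosetToSymPos c).form x y)
      = (((gram h).1 * X + Xᵀ * (gram h).1) *ᵥ x) ⬝ᵥ y := by
  rw [cosetTangent_coset (isSmoothOnCosets_form x y)]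
  let tr : Matrix (Fin n) (Fin n) ℝ →L[ℝ] Matrix (Fin n) (Fin n) ℝ :=
    LinearMap.toContinuousLinearMap (Matrix.transposeLinearEquiv (Fin n) (Fin n) ℝ ℝ).toLinearMap
  let L : Matrix (Fin n) (Fin n) ℝ →L[ℝ] ℝ := LinearMap.toContinuousLinearMap
    { toFun := fun A => (A *ᵥ x) ⬝ᵥ y
      map_add' := fun A B => by rw [Matrix.add_mulVec, add_dotProduct]
      map_smul' := fun r A => by rw [Matrix.smul_mulVec, smul_dotProduct]; rfl }
  have h1 : HasFDerivAt (fun A : Matrix (Fin n) (Fin n) ℝ => L (tr A * A)) _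
      (h : Matrix (Fin n) (Fin n) ℝ) :=
    L.hasFDerivAt.comp _ (tr.hasFDerivAt.mul' (hasFDerivAt_id _))
  have heq : (onGL fun g : GL (Fin n) ℝ => (cosetToSymPos (coset g)).form x y)
      =ᶠ[nhds (h : Matrix (Fin n) (Fin n) ℝ)] fun A => L (tr A * A) := by
    filter_upwards [isOpen_isUnit_matrix.mem_nhds h.isUnit] with A hA
    obtain ⟨a, rfl⟩ := hA
    rw [onGL_coe]
    rfl
  have h2 := DFunLike.congr_fun (h1.congr_of_eventuallyEq heq).fderiv
    ((h : Matrix (Fin n) (Fin n) ℝ) * X)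
  refine h2.trans ?_
  change L ((h : Matrix (Fin n) (Fin n) ℝ)ᵀ * (h * X) + ((h : Matrix (Fin n) (Fin n) ℝ) * X)ᵀ * h)
    = L _
  rw [Matrix.transpose_mul, mul_assoc, ← mul_assoc]
  rfl

variable [FiniteDimensional ℝ V]

theorem gram_mul_translatedMomentMap (ρ : Representation ℝ (GL (Fin n) ℝ) V) (h : GL (Fin n) ℝ)
    (v : V) : (gram h).1 * translatedMomentMap ρ h⁻¹ v
      = (h : Matrix (Fin n) (Fin n) ℝ)ᵀ * momentMap ρ (ρ h v) * h := by
  change (h : Matrix (Fin n) (Fin n) ℝ)ᵀ * h * _ = _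
  rw [mul_assoc, mul_translatedMomentMap_inv, mul_assoc]

/-- For s = hᵀh and M = m^{h⁻¹ · ḡ}(v), the product sM equals hᵀ m(ρ(h)v) h, which is symmetric.
This turns sM + Mᵀs into 2sM and explains the factor 2 in the metric flow. -/
theorem transpose_translatedMomentMap_mul_gram (ρ : Representation ℝ (GL (Fin n) ℝ) V)
    (h : GL (Fin n) ℝ) (v : V) :
    (translatedMomentMap ρ h⁻¹ v)ᵀ * (gram h).1 = (gram h).1 * translatedMomentMap ρ h⁻¹ v := by
  have h1 : ((gram h).1 * translatedMomentMap ρ h⁻¹ v)ᵀ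
      = (gram h).1 * translatedMomentMap ρ h⁻¹ v := by
    rw [gram_mul_translatedMomentMap]
    simp only [Matrix.transpose_mul, Matrix.transpose_transpose, momentMap_isSymm, mul_assoc]
  rwa [Matrix.transpose_mul, (gram h).2.transpose_eq] at h1

/-! ### Solutions of the moment map flow are solutions of the metric flow -/

theorem momentMapFlow_to_metricFlow {ρ : Representation ℝ (GL (Fin n) ℝ) V}
    (halg : IsAlgebraic ρ) (hρ : IsAdapted ρ) {vbar : V} {h₀ : GL (Fin n) ℝ} {T : ℝ}
    {c : Set.Ico (0 : ℝ) T → CosetSpace n}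
    (hc : c ∈ momentMapFlowSolutions hρ vbar (coset h₀) T) :
    (fun t => cosetToSymPos (c t)) ∈ metricFlowSolutions ρ vbar (gram h₀) T := by
  refine ⟨fun t ht => congrArg cosetToSymPos (hc.1 t ht), fun t x y => ?_⟩
  refine (hc.2 t _ (isSmoothOnCosets_form x y)).congr_deriv ?_
  obtain ⟨h, hh⟩ : ∃ h, coset h = c t := Quotient.exists_rep (c t)
  have hg : cosetToSymPos (c t) = gram h := by rw [← hh]; rfl
  beta_reduce
  rw [hg, ← hh, Pi.neg_apply, cosetTangent_form, momentMapOf_coset, momentMapOf_gram halg hρ,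
    transpose_translatedMomentMap_mul_gram, SymPos.form, Matrix.mulVec_mulVec, ← two_smul ℝ,
    Matrix.smul_mulVec, smul_dotProduct, smul_eq_mul, neg_mul]

/-! ### Lifts to `GL_n(ℝ)` -/

/-- Solutions on `[0, T)` of the equation `h' = -m(ρ(h) v̄) h`, `h(0) = h₀` on `GL_n(ℝ)`. -/
def liftSolutions (ρ : Representation ℝ (GL (Fin n) ℝ) V) (vbar : V) (h₀ : GL (Fin n) ℝ) (T : ℝ) :
    Set (Set.Ico (0 : ℝ) T → GL (Fin n) ℝ) :=
  {h | IsLiftAlong ρ h₀ (fun t => ρ (h t) vbar) h}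

/-- The sign is absorbed into the coefficient, giving the shape X * k needed in
`hasDerivWithinAt_rep`. -/
theorem mem_liftSolutions_iff {ρ : Representation ℝ (GL (Fin n) ℝ) V} {vbar : V}
    {h₀ : GL (Fin n) ℝ} {T : ℝ} (hT : 0 < T) (k : ℝ → GL (Fin n) ℝ) :
    (fun τ : Set.Ico (0 : ℝ) T => k τ) ∈ liftSolutions ρ vbar h₀ T ↔ k 0 = h₀ ∧
      ∀ t ∈ Set.Ico 0 T, HasDerivWithinAt (fun τ => (k τ : Matrix (Fin n) (Fin n) ℝ))
        (-momentMap ρ (ρ (k t) vbar) * (k t : Matrix (Fin n) (Fin n) ℝ)) (Set.Ico 0 T) t := by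
  refine and_congr ⟨fun h => h ⟨0, le_rfl, hT⟩ rfl, fun h t ht => ?_⟩
    ⟨fun h t ht => ?_, fun h t => ?_⟩
  · change k t = h₀
    rw [ht, h]
  · rw [neg_mul]
    exact (hasDerivWithinAt_onIco_iff ht).1 (h ⟨t, ht⟩)
  · have := h t t.2
    rw [neg_mul] at this
    exact (hasDerivWithinAt_onIco_iff t.2).2 this

theorem mem_gradientFlowSolutions_iff {ρ : Representation ℝ (GL (Fin n) ℝ) V} {v₀ : V} {T : ℝ}
    (hT : 0 < T) (u : ℝ → V) :
    (fun τ : Set.Ico (0 : ℝ) T => u τ) ∈ gradientFlowSolutions ρ v₀ T ↔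
      (∀ t ∈ Set.Ico 0 T, u t ≠ 0) ∧ u 0 = v₀ ∧
      ∀ t ∈ Set.Ico 0 T,
        HasDerivWithinAt u (dRep ρ (-momentMap ρ (u t)) (u t)) (Set.Ico 0 T) t := by
  refine and_congr ⟨fun h t ht => h ⟨t, ht⟩, fun h t => h t t.2⟩
    (and_congr ⟨fun h => h ⟨0, le_rfl, hT⟩ rfl, fun h t ht => ?_⟩
      ⟨fun h t ht => ?_, fun h t => ?_⟩)
  · change u t = v₀
    rw [ht, h]
  · rw [map_neg]
    exact (hasDerivWithinAt_onIco_iff ht).1 (h ⟨t, ht⟩)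
  · have := h t t.2
    rw [map_neg] at this
    exact (hasDerivWithinAt_onIco_iff t.2).2 this

theorem liftSolutions_to_gradientFlow {ρ : Representation ℝ (GL (Fin n) ℝ) V}
    (halg : IsAlgebraic ρ) {vbar : V} (hvbar : vbar ≠ 0) {h₀ : GL (Fin n) ℝ} {T : ℝ} (hT : 0 < T)
    {h : Set.Ico (0 : ℝ) T → GL (Fin n) ℝ} (hh : h ∈ liftSolutions ρ vbar h₀ T) :
    (fun t => ρ (h t) vbar) ∈ gradientFlowSolutions ρ (ρ h₀ vbar) T := by
  obtain ⟨k, rfl⟩ := exists_extension h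
  obtain ⟨h0, hd⟩ := (mem_liftSolutions_iff hT k).1 hh
  refine (mem_gradientFlowSolutions_iff hT fun t => ρ (k t) vbar).2
    ⟨fun t _ hz => hvbar ?_, by rw [h0], fun t ht => hasDerivWithinAt_rep halg (hd t ht) vbar⟩
  have := congrArg (ρ (k t)⁻¹) hz
  simpa only [rep_mul_apply, inv_mul_cancel, map_one, Module.End.one_apply, map_zero] using this

theorem liftSolutions_to_momentMapFlow {ρ : Representation ℝ (GL (Fin n) ℝ) V}
    (hρ : IsAdapted ρ) {vbar : V} {h₀ : GL (Fin n) ℝ} {T : ℝ} (hT : 0 < T)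
    {h : Set.Ico (0 : ℝ) T → GL (Fin n) ℝ} (hh : h ∈ liftSolutions ρ vbar h₀ T) :
    (fun t => coset (h t)) ∈ momentMapFlowSolutions hρ vbar (coset h₀) T := by
  refine ⟨fun t ht => congrArg coset (hh.1 t ht), fun t f hf => ?_⟩
  obtain ⟨k, rfl⟩ := exists_extension h
  have h1 := ((mem_liftSolutions_iff hT k).1 hh).2 t t.2
  rw [hasDerivWithinAt_onIco_iff (k := fun τ => f (coset (k τ))) t.2]
  beta_reduce
  rw [momentMapOf_coset]
  refine hasDerivWithinAt_comp_coset hf ?_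
  rwa [mul_translatedMomentMap_inv, ← neg_mul]

end MomentFlow
end

noncomputable section
namespace MomentFlow

variable {n : ℕ} {V : Type*} [NormedAddCommGroup V] [InnerProductSpace ℝ V]
variable [FiniteDimensional ℝ V]

open scoped Matrix.Norms.Operator

/-! ### Continuity of the moment map and lifts of gradient flow lines -/

theorem continuousOn_matrix {s : Set ℝ} {M : ℝ → Matrix (Fin n) (Fin n) ℝ}
    (h : ∀ i j, ContinuousOn (fun t => M t i j) s) : ContinuousOn M s :=
  continuousOn_pi.2 fun i => continuousOn_pi.2 fun j => h i j

theorem continuousOn_momentMap (ρ : Representation ℝ (GL (Fin n) ℝ) V) {s : Set ℝ} {u : ℝ → V}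
    (hu : ContinuousOn u s) (h0 : ∀ t ∈ s, u t ≠ 0) :
    ContinuousOn (fun t => momentMap ρ (u t)) s := by
  refine continuousOn_matrix fun i j => ?_
  simp only [momentMap, Matrix.of_apply, rayleigh]
  refine ContinuousOn.div (ContinuousOn.inner (𝕜 := ℝ) ?_ hu) (ContinuousOn.inner (𝕜 := ℝ) hu hu)
    fun t ht => inner_self_ne_zero.2 (h0 t ht)
  exact (ContinuousLinearMap.continuous _).comp_continuousOn hu

theorem continuousOn_gradientFlow {ρ : Representation ℝ (GL (Fin n) ℝ) V} {v₀ : V} {T : ℝ}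
    (hT : 0 < T) {u : ℝ → V}
    (hu : (fun τ : Set.Ico (0 : ℝ) T => u τ) ∈ gradientFlowSolutions ρ v₀ T) :
    ContinuousOn (fun t => -momentMap ρ (u t)) (Set.Ico 0 T) := by
  obtain ⟨hne, -, hd⟩ := (mem_gradientFlowSolutions_iff hT u).1 hu
  exact (continuousOn_momentMap ρ (fun t ht => (hd t ht).continuousWithinAt) hne).neg

/-- Solutions of the gradient flow lift to `GL_n(ℝ)`. -/
theorem exists_lift_of_gradientFlow {ρ : Representation ℝ (GL (Fin n) ℝ) V}
    (halg : IsAlgebraic ρ) {vbar : V} {h₀ : GL (Fin n) ℝ} {T : ℝ} (hT : 0 < T)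
    {v : Set.Ico (0 : ℝ) T → V} (hv : v ∈ gradientFlowSolutions ρ (ρ h₀ vbar) T) :
    ∃ h ∈ liftSolutions ρ vbar h₀ T, (fun t => ρ (h t) vbar) = v := by
  obtain ⟨u, rfl⟩ := exists_extension v
  obtain ⟨-, h0, hd⟩ := (mem_gradientFlowSolutions_iff hT u).1 hv
  have hB := continuousOn_gradientFlow hT hv
  obtain ⟨k, hk0, hk, -⟩ := exists_fundamental_solution hT hB h₀
  -- Freezing the coefficient m(u(t)) along the given solution makes the gradient flow a linear
  -- equation, solved by both curves.
  have key : Set.EqOn (fun t => ρ (k t) vbar) u (Set.Ico 0 T) :=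
    eqOn_of_hasDerivWithinAt_linear (A := fun t => dRep ρ (-momentMap ρ (u t)))
      ((dRep ρ).continuous.comp_continuousOn hB)
      (fun t ht => hasDerivWithinAt_rep halg (hk t ht) vbar) hd (by rw [hk0, h0])
  refine ⟨fun τ => k τ, (mem_liftSolutions_iff hT k).2 ⟨hk0, fun t ht => ?_⟩,
    funext fun t => key t.2⟩
  have := key ht
  beta_reduce at this
  rw [this]
  exact hk t ht

/-- Once the curve v in V is fixed, both lifts solve the same linear equation h' = -m(v(t))h. -/
theorem liftSolutions_ext_of_rep {ρ : Representation ℝ (GL (Fin n) ℝ) V}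
    (halg : IsAlgebraic ρ) {vbar : V} (hvbar : vbar ≠ 0) {h₀ : GL (Fin n) ℝ} {T : ℝ} (hT : 0 < T)
    {h h' : Set.Ico (0 : ℝ) T → GL (Fin n) ℝ} (hh : h ∈ liftSolutions ρ vbar h₀ T)
    (hh' : h' ∈ liftSolutions ρ vbar h₀ T)
    (he : (fun t => ρ (h t) vbar) = fun t => ρ (h' t) vbar) : h = h' := by
  obtain ⟨k, rfl⟩ := exists_extension h
  obtain ⟨k', rfl⟩ := exists_extension h'
  have hB := continuousOn_gradientFlow (u := fun t => ρ (k t) vbar) hT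
    (liftSolutions_to_gradientFlow halg hvbar hT hh)
  obtain ⟨h0, hd⟩ := (mem_liftSolutions_iff hT k).1 hh
  obtain ⟨h0', hd'⟩ := (mem_liftSolutions_iff hT k').1 hh'
  let l := ContinuousLinearMap.mul ℝ (Matrix (Fin n) (Fin n) ℝ)
  have key := eqOn_of_hasDerivWithinAt_linear
    (A := fun t => l (-momentMap ρ (ρ (k t) vbar))) (l.continuous.comp_continuousOn hB) hd
    (g := fun t => (k' t : Matrix (Fin n) (Fin n) ℝ)) (fun t ht => by
      have := congrFun he ⟨t, ht⟩
      beta_reduce at this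
      rw [this]
      exact hd' t ht) (by rw [h0, h0'])
  exact funext fun t => Units.ext (key t.2)

/-! ### Solutions of the metric flow -/

theorem metricFlowSolutions_hasDerivWithinAt {ρ : Representation ℝ (GL (Fin n) ℝ) V} {vbar : V}
    {s₀ : SymPos n} {T : ℝ} {σ : ℝ → SymPos n}
    (h : (fun τ : Set.Ico (0 : ℝ) T => σ τ) ∈ metricFlowSolutions ρ vbar s₀ T) {t : ℝ}
    (ht : t ∈ Set.Ico 0 T) :
    HasDerivWithinAt (fun τ => (σ τ).1)
      ((-2 : ℝ) • ((σ t).1 * momentMapOf ρ (symPosMetric ρ (σ t)) vbar)) (Set.Ico 0 T) t := by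
  refine hasDerivWithinAt_pi.2 fun i => hasDerivWithinAt_pi.2 fun j => ?_
  -- Evaluating the form on (e_j, e_i) gives the (i, j) entry.
  have := (hasDerivWithinAt_onIco_iff (k := fun τ => (σ τ).form (Pi.single j 1) (Pi.single i 1))
    ht).1 (h.2 ⟨t, ht⟩ (Pi.single j 1) (Pi.single i 1))
  simp only [SymPos.form, Matrix.mulVec_mulVec] at this
  simpa using this

theorem continuousOn_symPosMetric {ρ : Representation ℝ (GL (Fin n) ℝ) V} (halg : IsAlgebraic ρ)
    {σ : ℝ → SymPos n} {s : Set ℝ} {D : ℝ → Matrix (Fin n) (Fin n) ℝ}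
    (hσ : ∀ t ∈ s, HasDerivWithinAt (fun τ => (σ τ).1) (D t) s t) (x y : V) :
    ContinuousOn (fun t => symPosMetric ρ (σ t) x y) s := by
  refine ContinuousOn.inner (𝕜 := ℝ) (fun t ht => ?_) continuousOn_const
  have h1 : HasDerivWithinAt (fun τ => ((σ τ).toGL : Matrix (Fin n) (Fin n) ℝ))
      (D t * (((σ t).toGL⁻¹ : GL (Fin n) ℝ) : Matrix (Fin n) (Fin n) ℝ) *
        ((σ t).toGL : Matrix (Fin n) (Fin n) ℝ)) s t :=
    (hσ t ht).congr_deriv (by rw [mul_assoc]; simp)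
  exact (hasDerivWithinAt_rep halg h1 x).continuousWithinAt

/-- `momentMapOf` chooses some h, so continuity is not visible from its definition. The trace
formula expresses each entry as a quotient of values of the scalar product ˢḡ, which vary
continuously with s. -/
theorem continuousOn_momentMapOf {ρ : Representation ℝ (GL (Fin n) ℝ) V} (halg : IsAlgebraic ρ)
    (hρ : IsAdapted ρ) {vbar : V} (hvbar : vbar ≠ 0)
    {σ : ℝ → SymPos n} {s : Set ℝ} {D : ℝ → Matrix (Fin n) (Fin n) ℝ}
    (hσ : ∀ t ∈ s, HasDerivWithinAt (fun τ => (σ τ).1) (D t) s t) :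
    ContinuousOn (fun t => momentMapOf ρ (symPosMetric ρ (σ t)) vbar) s := by
  have hpos : ∀ A : SymPos n, symPosMetric ρ A vbar vbar ≠ 0 := by
    intro A h0
    obtain ⟨h, rfl⟩ := gram_surjective A
    rw [symPosMetric_gram halg hρ, translatedMetric, inner_self_eq_zero, inv_inv] at h0
    have := congrArg (ρ h⁻¹) h0
    rw [rep_mul_apply, inv_mul_cancel, map_one, Module.End.one_apply, map_zero] at this
    exact hvbar this
  refine continuousOn_matrix fun i j => ?_
  -- The indices are swapped because tr(M E_ji) = M_ij.
  have hentry : ∀ t, momentMapOf ρ (symPosMetric ρ (σ t)) vbar i j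
      = symPosMetric ρ (σ t) (dRep ρ (Matrix.single j i 1) vbar) vbar /
        symPosMetric ρ (σ t) vbar vbar := by
    intro t
    obtain ⟨h, hh⟩ := gram_surjective (σ t)
    rw [← hh, momentMapOf_gram halg hρ, symPosMetric_gram halg hρ, ← translatedMomentMap_trace hρ,
      Matrix.trace_mul_single]
    simp
  simp only [hentry]
  exact (continuousOn_symPosMetric halg hσ _ _).div (continuousOn_symPosMetric halg hσ _ _)
    fun t _ => hpos _

/-- Solutions of the metric flow lift to `GL_n(ℝ)`. -/
theorem exists_lift_of_metricFlow {ρ : Representation ℝ (GL (Fin n) ℝ) V}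
    (halg : IsAlgebraic ρ) (hρ : IsAdapted ρ) {vbar : V} (hvbar : vbar ≠ 0) {h₀ : GL (Fin n) ℝ}
    {T : ℝ} (hT : 0 < T)
    {s : Set.Ico (0 : ℝ) T → SymPos n} (hs : s ∈ metricFlowSolutions ρ vbar (gram h₀) T) :
    ∃ h ∈ liftSolutions ρ vbar h₀ T, (fun t => gram (h t)) = s := by
  have : Nonempty (SymPos n) := ⟨gram h₀⟩
  obtain ⟨σ, rfl⟩ := exists_extension s
  have h0 : σ 0 = gram h₀ := hs.1 ⟨0, le_rfl, hT⟩ rfl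
  have hd := fun t ht => metricFlowSolutions_hasDerivWithinAt (t := t) hs ht
  have hM := continuousOn_momentMapOf halg hρ hvbar hd
  set M : ℝ → Matrix (Fin n) (Fin n) ℝ := fun t => momentMapOf ρ (symPosMetric ρ (σ t)) vbar
    with hMdef
  -- The lift is k⁻¹: if k' = Mk, then (k⁻¹)' = -k⁻¹M.
  obtain ⟨k, hk0, -, hk⟩ := exists_fundamental_solution hT hM h₀⁻¹
  let tr : Matrix (Fin n) (Fin n) ℝ →L[ℝ] Matrix (Fin n) (Fin n) ℝ :=
    LinearMap.toContinuousLinearMap (Matrix.transposeLinearEquiv (Fin n) (Fin n) ℝ ℝ).toLinearMap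
  let l := ContinuousLinearMap.mul ℝ (Matrix (Fin n) (Fin n) ℝ)
  -- The operator is S ↦ -(SM + MᵀS) rather than S ↦ -2SM: as long as the Gram matrix of k⁻¹ is not
  -- known to be σ, its product with M need not be symmetric.
  have hA : ContinuousOn (fun t => -(l.flip (M t) + l (tr (M t)))) (Set.Ico 0 T) :=
    ((l.flip.continuous.comp_continuousOn hM).add
      (l.continuous.comp_continuousOn (tr.continuous.comp_continuousOn hM))).neg
  have key : Set.EqOn (fun t => (gram (k t)⁻¹).1) (fun t => (σ t).1) (Set.Ico 0 T) := by
    refine eqOn_of_hasDerivWithinAt_linear hA (fun t ht => ?_) (fun t ht => ?_) ?_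
    · have h1 := (tr.hasFDerivAt.comp_hasDerivWithinAt t (hk t ht)).mul (hk t ht)
      refine h1.congr_deriv ?_
      set a : Matrix (Fin n) (Fin n) ℝ := (((k t)⁻¹ : GL (Fin n) ℝ) : Matrix (Fin n) (Fin n) ℝ)
      change (-(a * M t))ᵀ * a + aᵀ * (-(a * M t)) = -(aᵀ * a * M t + (M t)ᵀ * (aᵀ * a))
      rw [Matrix.transpose_neg, Matrix.transpose_mul]
      noncomm_ring
    · refine (hd t ht).congr_deriv ?_
      change _ = -((σ t).1 * M t + (M t)ᵀ * (σ t).1)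
      obtain ⟨h, hh⟩ := gram_surjective (σ t)
      simp only [hMdef, ← hh, momentMapOf_gram halg hρ, transpose_translatedMomentMap_mul_gram]
      rw [← two_smul ℝ, neg_smul]
    · simp only [hk0, inv_inv, h0]
  have hg : ∀ t ∈ Set.Ico 0 T, gram (k t)⁻¹ = σ t := fun t ht => Subtype.ext (key ht)
  refine ⟨fun τ => (k τ)⁻¹, (mem_liftSolutions_iff hT fun τ => (k τ)⁻¹).2
    ⟨by rw [hk0, inv_inv], fun t ht => ?_⟩, funext fun t => hg t t.2⟩
  refine (hk t ht).congr_deriv ?_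
  rw [neg_mul, ← mul_translatedMomentMap_inv, ← momentMapOf_gram halg hρ, hg t ht]

/-- Once the Gram curve s is fixed, both lifts solve h' = -hM with M = m^{ˢḡ}(v̄), which depends on
s alone. -/
theorem liftSolutions_ext_of_gram {ρ : Representation ℝ (GL (Fin n) ℝ) V}
    (halg : IsAlgebraic ρ) (hρ : IsAdapted ρ) {vbar : V} (hvbar : vbar ≠ 0) {h₀ : GL (Fin n) ℝ}
    {T : ℝ} (hT : 0 < T)
    {h h' : Set.Ico (0 : ℝ) T → GL (Fin n) ℝ} (hh : h ∈ liftSolutions ρ vbar h₀ T)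
    (hh' : h' ∈ liftSolutions ρ vbar h₀ T)
    (he : (fun t => gram (h t)) = fun t => gram (h' t)) : h = h' := by
  have hs := momentMapFlow_to_metricFlow halg hρ (liftSolutions_to_momentMapFlow hρ hT hh)
  obtain ⟨k, rfl⟩ := exists_extension h
  obtain ⟨k', rfl⟩ := exists_extension h'
  have hM := continuousOn_momentMapOf halg hρ hvbar
    fun t ht => metricFlowSolutions_hasDerivWithinAt (σ := fun t => gram (k t)) hs (t := t) ht
  obtain ⟨h0, hd⟩ := (mem_liftSolutions_iff hT k).1 hh
  obtain ⟨h0', hd'⟩ := (mem_liftSolutions_iff hT k').1 hh'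
  let l := ContinuousLinearMap.mul ℝ (Matrix (Fin n) (Fin n) ℝ)
  have hrw : ∀ g : GL (Fin n) ℝ, -momentMap ρ (ρ g vbar) * (g : Matrix (Fin n) (Fin n) ℝ)
      = g * -momentMapOf ρ (symPosMetric ρ (gram g)) vbar := fun g => by
    rw [momentMapOf_gram halg hρ, mul_neg, mul_translatedMomentMap_inv, neg_mul]
  have key := eqOn_of_hasDerivWithinAt_linear
    (A := fun t => l.flip (-momentMapOf ρ (symPosMetric ρ (gram (k t))) vbar))
    (l.flip.continuous.comp_continuousOn hM.neg)
    (f := fun t => (k t : Matrix (Fin n) (Fin n) ℝ))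
    (g := fun t => (k' t : Matrix (Fin n) (Fin n) ℝ))
    (fun t ht => (hd t ht).congr_deriv (hrw _)) (fun t ht => by
      have := congrFun he ⟨t, ht⟩
      beta_reduce at this
      rw [this]
      exact (hd' t ht).congr_deriv (hrw _)) (by rw [h0, h0'])
  exact funext fun t => Units.ext (key t.2)

end MomentFlow
end

noncomputable section
namespace MomentFlow

variable {n : ℕ} {V : Type*} [NormedAddCommGroup V] [InnerProductSpace ℝ V]
variable [FiniteDimensional ℝ V]

/-! ### The correspondences -/

variable {ρ : Representation ℝ (GL (Fin n) ℝ) V} {vbar : V} {T : ℝ}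

/-- The correspondence `h ↦ ρ(h) v̄`. -/
def liftEquivGradientFlow (halg : IsAlgebraic ρ) (hvbar : vbar ≠ 0) (h₀ : GL (Fin n) ℝ)
    (hT : 0 < T) : liftSolutions ρ vbar h₀ T ≃ gradientFlowSolutions ρ (ρ h₀ vbar) T :=
  Equiv.ofBijective
    (fun h => ⟨fun t => ρ (h.1 t) vbar, liftSolutions_to_gradientFlow halg hvbar hT h.2⟩)
    ⟨fun h h' he => Subtype.ext
      (liftSolutions_ext_of_rep halg hvbar hT h.2 h'.2 (congrArg Subtype.val he)),
    fun v => by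
      obtain ⟨h, hh, he⟩ := exists_lift_of_gradientFlow halg hT v.2
      exact ⟨⟨h, hh⟩, Subtype.ext he⟩⟩

/-- The correspondence `h ↦ K h`. -/
def liftEquivMomentMapFlow (halg : IsAlgebraic ρ) (hρ : IsAdapted ρ) (hvbar : vbar ≠ 0)
    (h₀ : GL (Fin n) ℝ) (hT : 0 < T) :
    liftSolutions ρ vbar h₀ T ≃ momentMapFlowSolutions hρ vbar (coset h₀) T :=
  Equiv.ofBijective
    (fun h => ⟨fun t => coset (h.1 t), liftSolutions_to_momentMapFlow hρ hT h.2⟩)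
    ⟨fun h h' he => Subtype.ext (liftSolutions_ext_of_gram halg hρ hvbar hT h.2 h'.2
      (congrArg (fun c t => cosetToSymPos (c.1 t)) he)),
    fun c => by
      -- The curve in K \ G is lifted by way of its image under φ; injectivity of φ shows that the
      -- lift lies over the original curve.
      obtain ⟨h, hh, he⟩ := exists_lift_of_metricFlow halg hρ hvbar hT
        (momentMapFlow_to_metricFlow halg hρ c.2)
      exact ⟨⟨h, hh⟩, Subtype.ext (funext fun t => cosetToSymPos_injective (congrFun he t))⟩⟩

/-- The correspondence `c ↦ φ ∘ c`. -/
def momentMapFlowEquivMetricFlow (halg : IsAlgebraic ρ) (hρ : IsAdapted ρ) (hvbar : vbar ≠ 0)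
    (h₀ : GL (Fin n) ℝ) (hT : 0 < T) :
    momentMapFlowSolutions hρ vbar (coset h₀) T ≃ metricFlowSolutions ρ vbar (gram h₀) T :=
  Equiv.ofBijective
    (fun c => ⟨fun t => cosetToSymPos (c.1 t), momentMapFlow_to_metricFlow halg hρ c.2⟩)
    ⟨fun c c' he => Subtype.ext (funext fun t =>
      cosetToSymPos_injective (congrFun (congrArg Subtype.val he) t)),
    fun s => by
      obtain ⟨h, hh, he⟩ := exists_lift_of_metricFlow halg hρ hvbar hT s.2
      exact ⟨⟨_, liftSolutions_to_momentMapFlow hρ hT hh⟩, Subtype.ext he⟩⟩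

end MomentFlow
end

theorem mainTheorem3 (n : ℕ) {V : Type*} [NormedAddCommGroup V] [InnerProductSpace ℝ V]
    [FiniteDimensional ℝ V] (ρ : Representation ℝ (GL (Fin n) ℝ) V)
    (halg : MomentFlow.IsAlgebraic ρ) (hρ : MomentFlow.IsAdapted ρ)
    (vbar : V) (hvbar : vbar ≠ 0) (h₀ : GL (Fin n) ℝ) (T : ℝ) (hT : 0 < T) :
    ∃ (e₁₂ : MomentFlow.gradientFlowSolutions ρ (ρ h₀ vbar) T ≃
          MomentFlow.momentMapFlowSolutions hρ vbar (MomentFlow.coset h₀) T)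
      (e₂₃ : MomentFlow.momentMapFlowSolutions hρ vbar (MomentFlow.coset h₀) T ≃
          MomentFlow.metricFlowSolutions ρ vbar (MomentFlow.gram h₀) T),
      (∀ v, ∃ h : Set.Ico (0 : ℝ) T → GL (Fin n) ℝ, MomentFlow.IsLiftAlong ρ h₀ v.1 h ∧
        ∀ t, v.1 t = ρ (h t) vbar ∧ (e₁₂ v).1 t = MomentFlow.coset (h t)) ∧
      ∀ c t, (e₂₃ c).1 t = MomentFlow.cosetToSymPos (c.1 t) := by

  let e := MomentFlow.liftEquivGradientFlow halg hvbar h₀ hT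
  refine ⟨e.symm.trans (MomentFlow.liftEquivMomentMapFlow halg hρ hvbar h₀ hT),
    MomentFlow.momentMapFlowEquivMetricFlow halg hρ hvbar h₀ hT, fun v => ?_, fun c t => rfl⟩
  -- Writing v as ρ(h)v̄ exhibits the required lift h, and the composite bijection sends v to Kh.
  obtain ⟨h, rfl⟩ := e.surjective v
  refine ⟨h.1, h.2, fun t => ⟨rfl, ?_⟩⟩
  rw [Equiv.trans_apply, Equiv.symm_apply_apply]
  rfl
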